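/- Let $2\le p<\infty$, let $d\ge 2$ be an integer and put $k=\lfloor d/2\rfloor$. For a complex polynomial $P$ let $\|P\|_\infty=\max_{|z|=1}|P(z)|$ and $\|P\|_p=\bigl(\int_{-\pi}^{\pi}|P(e^{i\theta})|^p\,\frac{d\theta}{2\pi}\bigr)^{1/p}$, and let $\mathscr C_{d,p}$ be the smallest constant $C$ such that $\|P\|_\infty^p\le C\|P\|_p^p$ for every polynomial $P$ of degree at most $d$. Let $T_d$ be the set of real sequences $\tau=(\tau_0,\dots,\tau_{k+1})$ with $0=\tau_0\le\tau_1\le\dots\le\tau_{k+1}=\pi$. For $\tau\in T_d$ and $0<\theta<\pi$ put $$K_{d,p}(\tau;\theta)=\sum_{n=0}^{k}\chi_{(\tau_n,\tau_{n+1})}(\theta)\,\frac{\sin\bigl((\frac{dp}{4}+\frac12)\theta-\frac p2\pi n\bigr)}{\sin(\theta/2)},$$ and for non-empty $\Lambda\subseteq T_d$ put $M_{d,p}^{\Lambda}(\theta)=\max_{\tau\in\Lambda}\max(K_{d,p}(\tau;\theta),0)$; write $M_{d,p}=M_{d,p}^{T_d}$. Then, with integrals taking values in $[0,\infty]$, $$\mathscr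 C_{d,p}\le\frac1\pi\int_0^\pi M_{d,p}(\theta)^2\,d\theta .$$ Moreover, $T_d$ may be replaced by any smaller set of sequences that contains the arguments of the zeros of an extremal polynomial: there are a polynomial $\varphi$ that minimizes $\|P\|_p^p$ among all polynomials $P$ of degree at most $d$ with $P(1)=1$, and a sequence $t\in T_d$, such that the zeros of $\varphi$, counted with multiplicity, are $e^{\pm it_1},\dots,e^{\pm it_k}$, together with $-1$ if $d$ is odd, and such that for every $\Lambda\subseteq T_d$ with $t\in\Lambda$ $$\mathscr C_{d,p}\le\frac1\pi\int_0^\pi M_{d,p}^{\Lambda}(\theta)^2\,d\theta .$$ In particular (take $\Lambda=\{t\}$), $\mathscr C_{d,p}\le\frac1\pi\int_0^\pi \max(K_{d,p}(t;\theta),0)^2\,d\theta$. -/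

import Mathlib

open Polynomial

noncomputable section

namespace PointEval

/-- The supremum norm of a polynomial on the unit circle. -/
def supNorm (P : ℂ[X]) : ℝ := ⨆ z : Circle, ‖P.eval (z : ℂ)‖

/-- The `L^p` norm of a polynomial on the unit circle, with normalized arc length `dθ / 2π`. -/
def lpNorm (p : ℝ) (P : ℂ[X]) : ℝ :=
  (∫ θ in (-Real.pi)..Real.pi,
    ‖P.eval (Complex.exp (θ * Complex.I))‖ ^ p / (2 * Real.pi)) ^ (1 / p)

/-- The smallest `C` with `‖P‖_∞ ^ p ≤ C ‖P‖_p ^ p` for all polynomials of degree at most `d`. -/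
def nikolskiiConst (d : ℕ) (p : ℝ) : ℝ :=
  sInf {C : ℝ | ∀ P : ℂ[X], P.natDegree ≤ d → supNorm P ^ p ≤ C * lpNorm p P ^ p}

/-- `φ` minimizes `‖P‖_p ^ p` among the polynomials `P` of degree at most `d` with `P(1) = 1`. -/
structure IsExtremal (d : ℕ) (p : ℝ) (φ : ℂ[X]) : Prop where
  natDegree_le : φ.natDegree ≤ d
  eval_one : φ.eval 1 = 1
  le : ∀ P : ℂ[X], P.natDegree ≤ d → P.eval 1 = 1 → lpNorm p φ ^ p ≤ lpNorm p P ^ p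

/-- Non-decreasing sequences `0 = τ_0 ≤ τ_1 ≤ ⋯ ≤ τ_{k+1} = π`, where `k = ⌊d/2⌋`. -/
def T (d : ℕ) : Set (Fin (d / 2 + 2) → ℝ) :=
  {τ | Monotone τ ∧ τ 0 = 0 ∧ τ (Fin.last (d / 2 + 1)) = Real.pi}

/-- The zeros of `φ`, with multiplicity, are `e^{± i τ_1}, …, e^{± i τ_k}`, and in addition `-1`
if `d` is odd. -/
def HasZeroArgs (d : ℕ) (φ : ℂ[X]) (τ : Fin (d / 2 + 2) → ℝ) : Prop :=
  ∃ c : ℂ, c ≠ 0 ∧ φ = C c * (X + 1) ^ (d % 2) * ∏ j : Fin (d / 2),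
    ((X - C (Complex.exp (τ j.succ.castSucc * Complex.I))) *
      (X - C (Complex.exp (-(τ j.succ.castSucc * Complex.I)))))

/-- The piecewise kernel `K_{d,p}(τ; θ)`. -/
def K (d : ℕ) (p : ℝ) (τ : Fin (d / 2 + 2) → ℝ) (θ : ℝ) : ℝ :=
  ∑ n : Fin (d / 2 + 1), (Set.Ioo (τ n.castSucc) (τ n.succ)).indicator
    (fun x : ℝ => Real.sin ((d * p / 4 + 1 / 2) * x - p / 2 * Real.pi * (n : ℕ)) /
      Real.sin (x / 2)) θ

/-- The maximum over `τ ∈ Λ` of the positive part of `K_{d,p}(τ; θ)`. For fixed `θ` only finitely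
many values occur, so that the supremum is a maximum when `Λ` is non-empty. -/
def M (d : ℕ) (p : ℝ) (Λ : Set (Fin (d / 2 + 2) → ℝ)) (θ : ℝ) : ℝ :=
  sSup ((fun τ => max (K d p τ θ) 0) '' Λ)

/-- `(1/π) ∫_0^π M_{d,p}(θ)² dθ`, with value in `[0, ∞]`: the integrand is non-negative, and its
integral may diverge at `θ = 0`. -/
def energy (d : ℕ) (p : ℝ) (Λ : Set (Fin (d / 2 + 2) → ℝ)) : ENNReal :=
  ENNReal.ofReal (1 / Real.pi) *
    ∫⁻ θ in Set.Icc 0 Real.pi, ENNReal.ofReal (M d p Λ θ ^ 2)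

end PointEval

end

open Polynomial

namespace PointEval

/-! A minimizer `φ` exists by compactness, and averaging it with its conjugate makes its
coefficients real. Rotating and rescaling an arbitrary polynomial shows that the constant is at most
`1 / ‖φ‖_p^p`, so it remains to bound `‖φ‖_p^p` from below.

If a factor `A` of `φ` can be exchanged for a `B` with the same modulus on the circle and the same
value at `1`, then the midpoint of the two polynomials has smaller norm, unless `A` and `B` agree
somewhere on the circle besides `1`. Multiplication by `z` thus forces degree exactly `d`, and
reflecting one zero in the circle forces all zeros onto it (`IsExtremal.eq_of_norm_eval_eq`).

Hence, up to a constant factor, `φ^(p/2)` has a branch `f`, analytic in the disc, continuous up to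
the boundary and holomorphic at `1`. On the arc between the `n`-th and `(n+1)`-th argument its phase
is `(p/2)(dθ/2 - nπ)`. Cauchy's theorem for `(f(z) - f(1)) / (z - 1)`, in real parts, becomes `∫_0^π
|φ|^(p/2) K = π |φ(1)|^(p/2) = π` (`integral_norm_eval_rpow_mul_K`).

Dropping the negative part of `K` and applying Cauchy–Schwarz gives `π² ≤ π ‖φ‖_p^p ∫_0^π max(K,
0)²`. Since `max(K, 0) ≤ M` as soon as the argument sequence of `φ` lies in `Λ`, both claims follow.
-/

/-- The `p`-th power of the `L^p` norm, as an integral. -/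
noncomputable def lpMass (p : ℝ) (P : ℂ[X]) : ℝ :=
  ∫ θ in (-Real.pi)..Real.pi, ‖P.eval (Complex.exp (θ * Complex.I))‖ ^ p / (2 * Real.pi)

theorem lpMass_nonneg (p : ℝ) (P : ℂ[X]) : 0 ≤ lpMass p P := by
  apply intervalIntegral.integral_nonneg (by linarith [Real.pi_pos])
  intro θ _
  positivity

theorem lpNorm_rpow {p : ℝ} (hp : 0 < p) (P : ℂ[X]) : lpNorm p P ^ p = lpMass p P := by
  rw [show lpNorm p P = lpMass p P ^ (1 / p) from rfl, ← Real.rpow_mul (lpMass_nonneg p P),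
    one_div_mul_cancel hp.ne', Real.rpow_one]

theorem continuous_lpMass_integrand {p : ℝ} (hp : 0 < p) (P : ℂ[X]) :
    Continuous fun θ : ℝ => ‖P.eval (Complex.exp (θ * Complex.I))‖ ^ p / (2 * Real.pi) := by
  have h : Continuous fun θ : ℝ => P.eval (Complex.exp (θ * Complex.I)) :=
    P.continuous.comp (by fun_prop)
  exact (h.norm.rpow_const fun _ => Or.inr hp.le).div_const _

/-! ### Positivity and strict comparison of the mass -/

theorem exp_mul_I_injOn :
    Set.InjOn (fun θ : ℝ => Complex.exp (θ * Complex.I)) (Set.Ioo 0 Real.pi) := by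
  intro a ha b hb h
  have h2 := congrArg Complex.re h
  simp only [Complex.exp_ofReal_mul_I_re] at h2
  exact Real.injOn_cos ⟨ha.1.le, ha.2.le⟩ ⟨hb.1.le, hb.2.le⟩ h2

/-- A non-zero polynomial does not vanish at some point of the open upper half circle. -/
theorem exists_eval_exp_ne_zero {P : ℂ[X]} (hP : P ≠ 0) :
    ∃ θ ∈ Set.Ioo 0 Real.pi, P.eval (Complex.exp (θ * Complex.I)) ≠ 0 := by
  by_contra! h
  apply hP
  apply Polynomial.eq_zero_of_infinite_isRoot
  refine ((Set.Ioo_infinite Real.pi_pos).image exp_mul_I_injOn).mono ?_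
  rintro _ ⟨θ, hθ, rfl⟩
  exact h θ hθ

theorem exp_mul_I_ne_one {θ : ℝ} (hθ : θ ∈ Set.Ioo 0 Real.pi) :
    Complex.exp (θ * Complex.I) ≠ 1 := by
  intro h
  have h2 := congrArg Complex.im h
  simp only [Complex.exp_ofReal_mul_I_im, Complex.one_im] at h2
  exact (Real.sin_pos_of_pos_of_lt_pi hθ.1 hθ.2).ne' h2

/-- The integrands are continuous, so strictness at a single point is enough; a point of the open
upper half circle where `P` does not vanish is automatically different from `1`. -/
theorem lpMass_lt {p : ℝ} (hp : 0 < p) {P Q : ℂ[X]} (hP : P ≠ 0)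
    (h : ∀ z : ℂ, ‖z‖ = 1 → ‖Q.eval z‖ ≤ ‖P.eval z‖)
    (hlt : ∀ z : ℂ, ‖z‖ = 1 → z ≠ 1 → P.eval z ≠ 0 → ‖Q.eval z‖ < ‖P.eval z‖) :
    lpMass p Q < lpMass p P := by
  obtain ⟨θ, hθ, hne⟩ := exists_eval_exp_ne_zero hP
  apply intervalIntegral.integral_lt_integral_of_continuousOn_of_le_of_exists_lt
    (by linarith [Real.pi_pos]) (continuous_lpMass_integrand hp Q).continuousOn
    (continuous_lpMass_integrand hp P).continuousOn
  · intro x _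
    have := h _ (Complex.norm_exp_ofReal_mul_I x)
    gcongr
  · refine ⟨θ, ⟨by linarith [hθ.1, Real.pi_pos], hθ.2.le⟩, ?_⟩
    have := hlt _ (Complex.norm_exp_ofReal_mul_I θ) (exp_mul_I_ne_one hθ) hne
    have hpi := Real.pi_pos
    gcongr

theorem lpMass_pos {p : ℝ} (hp : 0 < p) {P : ℂ[X]} (hP : P ≠ 0) : 0 < lpMass p P := by
  have h : lpMass p (0 : ℂ[X]) < lpMass p P :=
    lpMass_lt hp hP (by simp) (by intro z _ _ hz; simpa using hz)
  exact (lpMass_nonneg p 0).trans_lt h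

/-! ### Scaling, rotation, conjugation and convexity -/

theorem lpMass_C_mul {p : ℝ} (c : ℂ) (P : ℂ[X]) :
    lpMass p (C c * P) = ‖c‖ ^ p * lpMass p P := by
  unfold lpMass
  rw [← intervalIntegral.integral_const_mul]
  congr 1
  ext θ
  rw [eval_mul, eval_C, norm_mul, Real.mul_rpow (norm_nonneg _) (norm_nonneg _), mul_div_assoc]

/-- Invariance of the `L^p` norm under rotations. -/
theorem lpMass_comp_rotate {p : ℝ} (s : ℝ) (P : ℂ[X]) :
    lpMass p (P.comp (C (Complex.exp (s * Complex.I)) * X)) = lpMass p P := by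
  set g : ℝ → ℝ := fun θ => ‖P.eval (Complex.exp (θ * Complex.I))‖ ^ p / (2 * Real.pi) with hg
  have hper : Function.Periodic g (2 * Real.pi) := by
    intro θ
    simp only [hg]
    have : Complex.exp (((θ + 2 * Real.pi : ℝ) : ℂ) * Complex.I) = Complex.exp (θ * Complex.I) := by
      push_cast
      rw [add_mul, Complex.exp_periodic]
    rw [this]
  have h1 : lpMass p (P.comp (C (Complex.exp (s * Complex.I)) * X)) =
      ∫ θ in (-Real.pi)..Real.pi, g (θ + s) := by
    unfold lpMass
    congr 1
    ext θ
    simp only [hg, eval_comp, eval_mul, eval_C, eval_X]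
    rw [← Complex.exp_add]
    congr 5
    push_cast
    ring
  have h2 : lpMass p P = ∫ θ in (-Real.pi)..Real.pi, g θ := rfl
  rw [h1, h2, intervalIntegral.integral_comp_add_right]
  have := hper.intervalIntegral_add_eq (-Real.pi + s) (-Real.pi)
  convert this using 2 <;> ring

/-- The polynomial with conjugate coefficients. -/
noncomputable def conjPoly (P : ℂ[X]) : ℂ[X] := P.map (starRingEnd ℂ)

theorem eval_conjPoly (P : ℂ[X]) (z : ℂ) :
    (conjPoly P).eval z = starRingEnd ℂ (P.eval (starRingEnd ℂ z)) := by
  have := Polynomial.eval_map_apply (f := starRingEnd ℂ) (p := P) (starRingEnd ℂ z)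
  rw [Complex.conj_conj] at this
  exact this

theorem conj_exp_mul_I (θ : ℝ) :
    starRingEnd ℂ (Complex.exp (θ * Complex.I)) = Complex.exp ((-θ : ℝ) * Complex.I) := by
  rw [← Complex.exp_conj]
  simp

theorem lpMass_conjPoly (p : ℝ) (P : ℂ[X]) : lpMass p (conjPoly P) = lpMass p P := by
  have h := intervalIntegral.integral_comp_neg (a := -Real.pi) (b := Real.pi)
    (fun θ : ℝ => ‖P.eval (Complex.exp (θ * Complex.I))‖ ^ p / (2 * Real.pi))
  rw [neg_neg] at h
  rw [lpMass, lpMass, ← h]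
  congr 1
  ext θ
  rw [eval_conjPoly, Complex.norm_conj, conj_exp_mul_I]

theorem lpMass_average_le {p : ℝ} (hp : 1 ≤ p) (P Q : ℂ[X]) :
    lpMass p (C (1 / 2) * (P + Q)) ≤ (lpMass p P + lpMass p Q) / 2 := by
  have hp0 : 0 < p := by linarith
  have hP := (continuous_lpMass_integrand hp0 P).intervalIntegrable (μ := MeasureTheory.volume)
    (-Real.pi) Real.pi
  have hQ := (continuous_lpMass_integrand hp0 Q).intervalIntegrable (μ := MeasureTheory.volume)
    (-Real.pi) Real.pi
  unfold lpMass
  rw [← intervalIntegral.integral_add hP hQ, ← intervalIntegral.integral_div]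
  apply intervalIntegral.integral_mono_on (by linarith [Real.pi_pos])
    ((continuous_lpMass_integrand hp0 _).intervalIntegrable _ _) ((hP.add hQ).div_const _)
  intro θ _
  set a := P.eval (Complex.exp (θ * Complex.I))
  set b := Q.eval (Complex.exp (θ * Complex.I))
  have h1 : ‖(C (1 / 2) * (P + Q)).eval (Complex.exp (θ * Complex.I))‖ ≤
      (1 / 2 : ℝ) * ‖a‖ + (1 / 2 : ℝ) * ‖b‖ := by
    rw [eval_mul, eval_C, eval_add, norm_mul]
    have := norm_add_le a b
    norm_num
    linarith
  have h2 := (convexOn_rpow hp).2 (norm_nonneg a) (norm_nonneg b)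
    (by norm_num : (0 : ℝ) ≤ 1 / 2) (by norm_num : (0 : ℝ) ≤ 1 / 2) (by norm_num)
  simp only [smul_eq_mul] at h2
  have h3 := (Real.rpow_le_rpow (norm_nonneg _) h1 hp0.le).trans h2
  rw [← add_div, div_right_comm]
  have hpi := Real.pi_pos
  gcongr
  linarith

/-! ### Existence of an extremal polynomial with real coefficients -/

/-- The polynomial with coefficient vector `a`. -/
noncomputable def ofCoeffs (d : ℕ) (a : Fin (d + 1) → ℂ) : ℂ[X] := ∑ i, C (a i) * X ^ (i : ℕ)

theorem eval_ofCoeffs (d : ℕ) (a : Fin (d + 1) → ℂ) (z : ℂ) :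
    (ofCoeffs d a).eval z = ∑ i, a i * z ^ (i : ℕ) := by
  simp [ofCoeffs, eval_finsetSum]

theorem natDegree_ofCoeffs (d : ℕ) (a : Fin (d + 1) → ℂ) : (ofCoeffs d a).natDegree ≤ d := by
  apply natDegree_sum_le_of_forall_le
  intro i _
  exact (natDegree_C_mul_X_pow_le _ _).trans (Nat.lt_succ_iff.mp i.2)

theorem ofCoeffs_coeff {d : ℕ} {P : ℂ[X]} (hP : P.natDegree ≤ d) :
    ofCoeffs d (fun i => P.coeff i) = P := by
  conv_rhs => rw [P.as_sum_range' (d + 1) (Nat.lt_succ_of_le hP)]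
  rw [ofCoeffs, ← Fin.sum_univ_eq_sum_range (fun i => monomial i (P.coeff i))]
  simp [C_mul_X_pow_eq_monomial]

theorem ofCoeffs_eq_zero {d : ℕ} {a : Fin (d + 1) → ℂ} (h : ofCoeffs d a = 0) : a = 0 := by
  ext i
  have := congrArg (fun P => P.coeff (i : ℕ)) h
  simp only [ofCoeffs, finsetSum_coeff, coeff_C_mul, coeff_X_pow, coeff_zero] at this
  rw [Finset.sum_eq_single i] at this
  · simpa using this
  · intro j _ hj
    have : (i : ℕ) ≠ j := fun h => hj (Fin.ext h.symm)
    simp [this]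
  · simp

theorem ofCoeffs_smul (d : ℕ) (c : ℂ) (a : Fin (d + 1) → ℂ) :
    ofCoeffs d (c • a) = C c * ofCoeffs d a := by
  simp [ofCoeffs, Finset.mul_sum, mul_assoc]

theorem continuous_lpMass_ofCoeffs {p : ℝ} (hp : 0 < p) (d : ℕ) :
    Continuous fun a : Fin (d + 1) → ℂ => lpMass p (ofCoeffs d a) := by
  apply intervalIntegral.continuous_parametric_intervalIntegral_of_continuous'
  simp only [Function.uncurry_def, eval_ofCoeffs]
  refine Continuous.div_const (Continuous.rpow_const ?_ fun _ => Or.inr hp.le) _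
  fun_prop

/-- The constraint set `P(1) = 1` is not compact. The homogeneous quotient `|P(1)|^p / ‖P‖_p^p` is
therefore maximized over the unit sphere of coefficient vectors, and the maximizer is rescaled. -/
theorem exists_lpMass_minimizer {p : ℝ} (hp : 0 < p) (d : ℕ) :
    ∃ φ : ℂ[X], φ.natDegree ≤ d ∧ φ.eval 1 = 1 ∧
      ∀ P : ℂ[X], P.natDegree ≤ d → P.eval 1 = 1 → lpMass p φ ≤ lpMass p P := by
  have hcpt : IsCompact (Metric.sphere (0 : Fin (d + 1) → ℂ) 1) := isCompact_sphere _ _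
  have hmem : ∀ a : Fin (d + 1) → ℂ, a ≠ 0 → ((‖a‖⁻¹ : ℝ) : ℂ) • a ∈ Metric.sphere 0 1 := by
    intro a ha
    have : ‖a‖ ≠ 0 := norm_ne_zero_iff.mpr ha
    simp [norm_smul, this]
  have hpos : ∀ a ∈ Metric.sphere (0 : Fin (d + 1) → ℂ) 1, 0 < lpMass p (ofCoeffs d a) := by
    intro a ha
    apply lpMass_pos hp
    intro h
    have := ofCoeffs_eq_zero h
    simp [this] at ha
  have hcont : ContinuousOn (fun a : Fin (d + 1) → ℂ =>
      ‖(ofCoeffs d a).eval 1‖ ^ p / lpMass p (ofCoeffs d a)) (Metric.sphere 0 1) := by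
    refine ContinuousOn.div ?_ (continuous_lpMass_ofCoeffs hp d).continuousOn
      fun a ha => (hpos a ha).ne'
    simp only [eval_ofCoeffs]
    refine (Continuous.rpow_const ?_ fun _ => Or.inr hp.le).continuousOn
    fun_prop
  -- the quotient at the normalized coefficient vector of `P` with `P(1) = 1`
  have hquot : ∀ P : ℂ[X], P.natDegree ≤ d → P.eval 1 = 1 →
      ∃ a ∈ Metric.sphere (0 : Fin (d + 1) → ℂ) 1,
        ‖(ofCoeffs d a).eval 1‖ ^ p / lpMass p (ofCoeffs d a) = 1 / lpMass p P := by
    intro P hP hP1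
    set b : Fin (d + 1) → ℂ := fun i => P.coeff i with hb
    have hbP : ofCoeffs d b = P := ofCoeffs_coeff hP
    have hb0 : b ≠ 0 := by
      intro h
      rw [h] at hbP
      rw [← hbP] at hP1
      simp [ofCoeffs] at hP1
    refine ⟨_, hmem b hb0, ?_⟩
    have hbn : (0 : ℝ) < ‖b‖⁻¹ := inv_pos.mpr (norm_pos_iff.mpr hb0)
    rw [ofCoeffs_smul, hbP, lpMass_C_mul, eval_mul, eval_C, hP1, mul_one, Complex.norm_real,
      Real.norm_of_nonneg hbn.le]
    have := (Real.rpow_pos_of_pos hbn p).ne'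
    rw [← div_div, div_self this]
  -- The constant polynomial `1` shows that the maximum is positive, so the maximizer does not
  -- vanish at `1`.
  obtain ⟨a₁, ha₁, hq₁⟩ := hquot 1 (by simp) (by simp)
  obtain ⟨a, ha, hmax⟩ := hcpt.exists_isMaxOn ⟨a₁, ha₁⟩ hcont
  set s := (ofCoeffs d a).eval 1 with hs
  have hma := hpos a ha
  have hs0 : s ≠ 0 := by
    intro h0
    have h1 : 1 / lpMass p 1 ≤ ‖s‖ ^ p / lpMass p (ofCoeffs d a) := hq₁ ▸ hmax ha₁
    rw [h0, norm_zero, Real.zero_rpow hp.ne', zero_div] at h1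
    exact absurd h1 (not_le.mpr (one_div_pos.mpr (lpMass_pos hp one_ne_zero)))
  have hsp : 0 < ‖s‖ ^ p := Real.rpow_pos_of_pos (norm_pos_iff.mpr hs0) p
  refine ⟨C s⁻¹ * ofCoeffs d a, (natDegree_C_mul_le _ _).trans (natDegree_ofCoeffs d a), ?_, ?_⟩
  · rw [eval_mul, eval_C, ← hs, inv_mul_cancel₀ hs0]
  · intro P hP hP1
    obtain ⟨b, hb, hq⟩ := hquot P hP hP1
    have h1 : 1 / lpMass p P ≤ ‖s‖ ^ p / lpMass p (ofCoeffs d a) := hq ▸ hmax hb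
    have hPpos : 0 < lpMass p P := lpMass_pos hp (by rintro rfl; simp at hP1)
    rw [lpMass_C_mul, norm_inv, Real.inv_rpow (norm_nonneg _)]
    rw [div_le_div_iff₀ hPpos hma, one_mul] at h1
    rw [inv_mul_le_iff₀ hsp]
    exact h1

theorem isExtremal_iff {d : ℕ} {p : ℝ} (hp : 0 < p) {φ : ℂ[X]} :
    IsExtremal d p φ ↔ φ.natDegree ≤ d ∧ φ.eval 1 = 1 ∧
      ∀ P : ℂ[X], P.natDegree ≤ d → P.eval 1 = 1 → lpMass p φ ≤ lpMass p P := by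
  constructor
  · rintro ⟨h1, h2, h3⟩
    simp only [lpNorm_rpow hp] at h3
    exact ⟨h1, h2, h3⟩
  · rintro ⟨h1, h2, h3⟩
    refine ⟨h1, h2, ?_⟩
    simpa only [lpNorm_rpow hp] using h3

theorem exists_isExtremal_conjPoly_eq {p : ℝ} (hp : 1 ≤ p) (d : ℕ) :
    ∃ φ : ℂ[X], IsExtremal d p φ ∧ conjPoly φ = φ := by
  have hp0 : 0 < p := by linarith
  obtain ⟨φ, h1, h2, h3⟩ := exists_lpMass_minimizer hp0 d
  have hdeg : (conjPoly φ).natDegree ≤ d := (natDegree_map_le).trans h1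
  refine ⟨C (1 / 2) * (φ + conjPoly φ), (isExtremal_iff hp0).mpr ⟨?_, ?_, ?_⟩, ?_⟩
  · exact (natDegree_C_mul_le _ _).trans (natDegree_add_le_of_degree_le h1 hdeg)
  · rw [eval_mul, eval_C, eval_add, eval_conjPoly, map_one, h2, map_one]
    norm_num
  · intro P hP hP1
    have := lpMass_average_le hp φ (conjPoly φ)
    rw [lpMass_conjPoly] at this
    linarith [h3 P hP hP1]
  · ext n
    simp [conjPoly, coeff_map, add_comm, map_ofNat]

/-! ### The point evaluation constant in terms of an extremal polynomial -/

theorem IsExtremal.ne_zero {d : ℕ} {p : ℝ} {φ : ℂ[X]} (h : IsExtremal d p φ) : φ ≠ 0 := by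
  rintro rfl
  simpa using h.eval_one

theorem bddAbove_range_norm_eval (P : ℂ[X]) :
    BddAbove (Set.range fun z : Circle => ‖P.eval (z : ℂ)‖) := by
  have h : Continuous fun z : Circle => ‖P.eval (z : ℂ)‖ :=
    (P.continuous.comp continuous_subtype_val).norm
  exact (isCompact_range h).bddAbove

theorem exists_supNorm_eq (P : ℂ[X]) : ∃ z : Circle, supNorm P = ‖P.eval (z : ℂ)‖ := by
  have h : Continuous fun z : Circle => ‖P.eval (z : ℂ)‖ :=
    (P.continuous.comp continuous_subtype_val).norm
  obtain ⟨z, -, hz⟩ := isCompact_univ.exists_isMaxOn ⟨(1 : Circle), trivial⟩ h.continuousOn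
  exact ⟨z, le_antisymm (ciSup_le fun w => hz (Set.mem_univ w))
    (le_ciSup (bddAbove_range_norm_eval P) z)⟩

theorem IsExtremal.supNorm_rpow_le {d : ℕ} {p : ℝ} (hp : 0 < p) {φ : ℂ[X]}
    (h : IsExtremal d p φ) {P : ℂ[X]} (hP : P.natDegree ≤ d) :
    supNorm P ^ p ≤ (lpMass p φ)⁻¹ * lpMass p P := by
  obtain ⟨-, -, hmin⟩ := (isExtremal_iff hp).mp h
  have hφ := lpMass_pos hp h.ne_zero
  obtain ⟨z, hz⟩ := exists_supNorm_eq P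
  rw [hz]
  set v := P.eval (z : ℂ) with hv
  rcases eq_or_ne v 0 with h0 | h0
  · rw [h0, norm_zero, Real.zero_rpow hp.ne']
    exact mul_nonneg (inv_nonneg.mpr hφ.le) (lpMass_nonneg p P)
  have hvp : 0 < ‖v‖ ^ p := Real.rpow_pos_of_pos (norm_pos_iff.mpr h0) p
  obtain ⟨s, hs⟩ : ∃ s : ℝ, Complex.exp (s * Complex.I) = z :=
    ⟨Complex.arg z, by
      have := Complex.norm_mul_exp_arg_mul_I (z : ℂ)
      rwa [Circle.norm_coe, Complex.ofReal_one, one_mul] at this⟩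
  -- The point where `|P|` is maximal is rotated to `1` and the value there normalized.
  have h1 := hmin (C v⁻¹ * P.comp (C (Complex.exp (s * Complex.I)) * X)) ?_ ?_
  · rw [lpMass_C_mul, lpMass_comp_rotate, norm_inv, Real.inv_rpow (norm_nonneg _),
      le_inv_mul_iff₀ hvp] at h1
    rw [le_inv_mul_iff₀ hφ]
    linarith
  · refine (natDegree_C_mul_le _ _).trans (natDegree_comp_le.trans ?_)
    calc P.natDegree * (C (Complex.exp (s * Complex.I)) * X).natDegree
        ≤ P.natDegree * 1 := Nat.mul_le_mul_left _ ((natDegree_C_mul_le _ _).trans natDegree_X_le)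
      _ ≤ d := by rwa [mul_one]
  · rw [eval_mul, eval_C, eval_comp, eval_mul, eval_C, eval_X, mul_one, hs, ← hv,
      inv_mul_cancel₀ h0]

theorem IsExtremal.nikolskiiConst_le {d : ℕ} {p : ℝ} (hp : 0 < p) {φ : ℂ[X]}
    (h : IsExtremal d p φ) : nikolskiiConst d p ≤ (lpMass p φ)⁻¹ := by
  apply csInf_le
  -- The real infimum needs a lower bound: testing with `P = 1` shows that admissible constants are
  -- non-negative.
  · refine ⟨0, fun c hc => ?_⟩
    have h1 := hc 1 (by simp)
    rw [lpNorm_rpow hp] at h1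
    have h2 : 0 ≤ supNorm 1 ^ p :=
      Real.rpow_nonneg (Real.iSup_nonneg fun z => norm_nonneg _) p
    have h3 := lpMass_pos hp (one_ne_zero : (1 : ℂ[X]) ≠ 0)
    by_contra! hneg
    nlinarith
  · intro P hP
    rw [lpNorm_rpow hp]
    exact h.supNorm_rpow_le hp hP

/-! ### Location of the zeros of an extremal polynomial -/

theorem norm_average_le {a b : ℂ} (h : ‖a‖ = ‖b‖) : ‖(a + b) / 2‖ ≤ ‖a‖ := by
  rw [norm_div]
  have := norm_add_le a b
  norm_num
  linarith

/-- Strict convexity from the parallelogram law: `|a + b|² = 4|a|² - |a - b|²`. -/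
theorem norm_average_lt {a b : ℂ} (h : ‖a‖ = ‖b‖) (hne : a ≠ b) : ‖(a + b) / 2‖ < ‖a‖ := by
  have h1 := parallelogram_law_with_norm ℝ a b
  have h2 : 0 < ‖a - b‖ := norm_pos_iff.mpr (sub_ne_zero.mpr hne)
  rw [norm_div]
  norm_num
  rw [← h] at h1
  nlinarith [norm_nonneg (a + b), norm_nonneg a]

/-- An extremal polynomial has no factorization `φ = A ψ` in which `A` may be replaced by another
factor `B` with the same modulus on the unit circle. -/
theorem IsExtremal.eq_of_norm_eval_eq {d : ℕ} {p : ℝ} (hp : 0 < p) {φ A B ψ : ℂ[X]}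
    (h : IsExtremal d p φ) (hφ : φ = A * ψ) (hdeg : (B * ψ).natDegree ≤ d)
    (hA : A.eval 1 = 1) (hB : B.eval 1 = 1)
    (hnorm : ∀ z : ℂ, ‖z‖ = 1 → ‖A.eval z‖ = ‖B.eval z‖) :
    ∃ z : ℂ, ‖z‖ = 1 ∧ z ≠ 1 ∧ A.eval z = B.eval z := by
  by_contra! hne
  obtain ⟨h1, h2, h3⟩ := (isExtremal_iff hp).mp h
  have hev : ∀ z, (C (1 / 2) * (φ + B * ψ)).eval z =
      (A.eval z + B.eval z) / 2 * ψ.eval z := by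
    intro z
    rw [eval_mul, eval_C, eval_add, hφ, eval_mul, eval_mul]
    ring
  have hφev : ∀ z, φ.eval z = A.eval z * ψ.eval z := fun z => by rw [hφ, eval_mul]
  have hlt : lpMass p (C (1 / 2) * (φ + B * ψ)) < lpMass p φ := by
    apply lpMass_lt hp h.ne_zero
    · intro z hz
      rw [hev, hφev, norm_mul, norm_mul]
      have := norm_average_le (hnorm z hz)
      gcongr
    · intro z hz hz1 hz0
      rw [hφev] at hz0
      rw [hev, hφev, norm_mul, norm_mul]
      have := norm_average_lt (hnorm z hz) (hne z hz hz1)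
      have h0 : 0 < ‖ψ.eval z‖ := norm_pos_iff.mpr (right_ne_zero_of_mul hz0)
      gcongr
  refine absurd (h3 _ ?_ ?_) (not_le.mpr hlt)
  · exact (natDegree_C_mul_le _ _).trans (natDegree_add_le_of_degree_le h1 hdeg)
  · rw [hev, hA, hB]
    rw [hφev, hA] at h2
    rw [one_mul] at h2
    rw [h2]
    norm_num

theorem IsExtremal.natDegree_eq {d : ℕ} {p : ℝ} (hp : 0 < p) {φ : ℂ[X]}
    (h : IsExtremal d p φ) : φ.natDegree = d := by
  refine le_antisymm h.natDegree_le ?_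
  by_contra! hlt
  -- Below degree `d` there is room for `X φ`, and `1 = z` holds only at `z = 1`.
  obtain ⟨z, -, hz1, hz⟩ := h.eq_of_norm_eval_eq hp (A := 1) (B := X) (ψ := φ) (by simp)
    (by rw [natDegree_X_mul h.ne_zero]; omega) (by simp) (by simp) (by intro z hz; simp [hz])
  simp at hz
  exact hz1 hz.symm

theorem IsExtremal.norm_eq_one_of_isRoot {d : ℕ} {p : ℝ} (hp : 0 < p) {φ : ℂ[X]}
    (h : IsExtremal d p φ) {w : ℂ} (hw : φ.IsRoot w) : ‖w‖ = 1 := by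
  obtain ⟨ψ, hψ⟩ := dvd_iff_isRoot.mpr hw
  have hψ0 : ψ ≠ 0 := by
    rintro rfl
    exact h.ne_zero (by rw [hψ, mul_zero])
  have hw1 : w ≠ 1 := by
    rintro rfl
    have := h.eval_one
    rw [hw.eq_zero] at this
    exact zero_ne_one this
  have ha : 1 - w ≠ 0 := sub_ne_zero.mpr hw1.symm
  have hb : 1 - starRingEnd ℂ w ≠ 0 := by
    have := (map_ne_zero (starRingEnd ℂ)).mpr ha
    simpa using this
  have hab : ‖1 - starRingEnd ℂ w‖ = ‖1 - w‖ := by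
    rw [← Complex.norm_conj (1 - w)]
    simp
  have hdeg : ψ.natDegree + 1 ≤ d := by
    have h1 := h.natDegree_le
    rw [hψ, natDegree_mul (X_sub_C_ne_zero w) hψ0, natDegree_X_sub_C] at h1
    omega
  -- The Blaschke reflection `z - w ↦ 1 - w̄ z` preserves the modulus on the circle; both factors
  -- are normalized at `1`. Their equality at `z` amounts to `(z - 1)(1 - |w|²) = 0`.
  obtain ⟨z, hz, hz1, heq⟩ := h.eq_of_norm_eval_eq hp (A := C (1 - w)⁻¹ * (X - C w))
    (B := C (1 - starRingEnd ℂ w)⁻¹ * (1 - C (starRingEnd ℂ w) * X)) (ψ := C (1 - w) * ψ)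
    (by
      rw [hψ]
      have : (C (1 - w)⁻¹ * C (1 - w) : ℂ[X]) = 1 := by
        rw [← C_mul, inv_mul_cancel₀ ha, C_1]
      linear_combination (-(X - C w) * ψ) * this)
    (by
      refine natDegree_mul_le.trans ?_
      have h1 : (C (1 - starRingEnd ℂ w)⁻¹ * (1 - C (starRingEnd ℂ w) * X)).natDegree ≤ 1 := by
        refine (natDegree_C_mul_le _ _).trans ?_
        refine (natDegree_sub_le _ _).trans (max_le (by simp) ((natDegree_C_mul_le _ _).trans natDegree_X_le))
      have h2 := natDegree_C_mul_le (1 - w) ψ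
      omega)
    (by simp [ha]) (by simp [hb])
    (by
      intro z hz
      simp only [eval_mul, eval_C, eval_sub, eval_X, Polynomial.eval_one, norm_mul, norm_inv, hab]
      congr 1
      have hzz : z * starRingEnd ℂ z = 1 := by
        rw [Complex.mul_conj, Complex.normSq_eq_norm_sq, hz]
        simp
      calc ‖z - w‖ = ‖starRingEnd ℂ (z - w)‖ := (Complex.norm_conj _).symm
        _ = ‖z‖ * ‖starRingEnd ℂ (z - w)‖ := by rw [hz, one_mul]
        _ = ‖z * starRingEnd ℂ (z - w)‖ := (norm_mul _ _).symm
        _ = ‖1 - starRingEnd ℂ w * z‖ := by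
          rw [map_sub, mul_sub, hzz, mul_comm z (starRingEnd ℂ w)])
  simp only [eval_mul, eval_C, eval_sub, eval_X, Polynomial.eval_one] at heq
  rw [inv_mul_eq_div, inv_mul_eq_div, div_eq_div_iff ha hb] at heq
  have h2 : (z - 1) * (1 - w * starRingEnd ℂ w) = 0 := by linear_combination heq
  have h3 := (mul_eq_zero.mp h2).resolve_left (sub_ne_zero.mpr hz1)
  rw [Complex.mul_conj, Complex.normSq_eq_norm_sq] at h3
  have h4 : ‖w‖ ^ 2 = 1 := by
    have := sub_eq_zero.mp h3
    exact_mod_cast this.symm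
  exact (pow_eq_one_iff_of_nonneg (norm_nonneg w) two_ne_zero).mp h4

/-! ### Conjugate pairs of zeros and their ordered arguments -/

/-- The real quadratic factor with zeros `e^{± i s}`. -/
noncomputable def zeroPair (s : ℝ) : ℂ[X] :=
  (X - C (Complex.exp (s * Complex.I))) * (X - C (Complex.exp (-(s * Complex.I))))

theorem zeroPair_arg {w : ℂ} (hw : ‖w‖ = 1) :
    zeroPair w.arg = (X - C w) * (X - C (starRingEnd ℂ w)) := by
  have h1 : Complex.exp (w.arg * Complex.I) = w := by
    have := Complex.norm_mul_exp_arg_mul_I w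
    rwa [hw, Complex.ofReal_one, one_mul] at this
  have h2 : Complex.exp (-(w.arg * Complex.I)) = starRingEnd ℂ w := by
    conv_rhs => rw [← h1]
    rw [conj_exp_mul_I]
    push_cast
    rw [neg_mul]
  rw [zeroPair, h1, h2]

theorem zeroPair_pi : zeroPair Real.pi = (X + 1) ^ 2 := by
  rw [zeroPair, Complex.exp_neg, Complex.exp_pi_mul_I]
  norm_num
  ring

theorem roots_map_conj {φ : ℂ[X]} (hconj : conjPoly φ = φ) :
    φ.roots.map (starRingEnd ℂ) = φ.roots := by
  have h := Splits.roots_map (f := φ) (IsAlgClosed.splits φ) (starRingEnd ℂ)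
  conv_rhs => rw [← hconj]
  exact h.symm

theorem filter_im_neg_roots {φ : ℂ[X]} (hconj : conjPoly φ = φ) :
    φ.roots.filter (fun w => w.im < 0) =
      (φ.roots.filter (fun w => 0 < w.im)).map (starRingEnd ℂ) := by
  conv_lhs => rw [← roots_map_conj hconj]
  rw [Multiset.filter_map]
  congr 1
  apply Multiset.filter_congr
  intro w _
  simp

/-- The zeros of a self-conjugate polynomial whose zeros lie on the unit circle, in terms of
arguments in `(0, π]`. -/
theorem exists_multiset_zeroPair {φ : ℂ[X]} (hconj : conjPoly φ = φ)
    (hnorm : ∀ w, φ.IsRoot w → ‖w‖ = 1) (hone : φ.eval 1 ≠ 0) :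
    ∃ S : Multiset ℝ, S.card = φ.natDegree / 2 ∧ (∀ s ∈ S, 0 < s ∧ s ≤ Real.pi) ∧
      φ = C φ.leadingCoeff * (X + 1) ^ (φ.natDegree % 2) * (S.map zeroPair).prod := by
  classical
  set R := φ.roots with hR
  set U := R.filter (fun w => 0 < w.im) with hU
  set Z := R.filter (fun w => w.im = 0) with hZ
  have hRU : R = U + U.map (starRingEnd ℂ) + Z := by
    rw [hU, ← filter_im_neg_roots hconj]
    conv_lhs => rw [← Multiset.filter_add_not (fun w : ℂ => 0 < w.im) R,
      ← Multiset.filter_add_not (fun w : ℂ => w.im < 0) (R.filter fun w => ¬ 0 < w.im)]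
    rw [Multiset.filter_filter, Multiset.filter_filter, add_assoc]
    congr 2
    · apply Multiset.filter_congr
      intro w _
      constructor
      · exact fun h => h.1
      · exact fun h => ⟨h, by linarith⟩
    · apply Multiset.filter_congr
      intro w _
      constructor
      · exact fun h => le_antisymm (not_lt.mp h.2) (not_lt.mp h.1)
      · intro h
        simp [h]
  have hroot : ∀ w ∈ R, ‖w‖ = 1 := fun w hw => hnorm w (isRoot_of_mem_roots hw)
  -- A real zero on the circle is `1` or `-1`, and `1` is excluded.
  have hZrep : Z = Multiset.replicate (Multiset.card Z) (-1) := by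
    rw [Multiset.eq_replicate_card]
    intro w hw
    rw [hZ, Multiset.mem_filter] at hw
    have hre : (w.re : ℂ) = w := by
      apply Complex.ext <;> simp [hw.2]
    have h1 := hroot w hw.1
    rw [← hre, Complex.norm_real, Real.norm_eq_abs] at h1
    rcases eq_or_eq_neg_of_abs_eq h1 with h | h
    · exfalso
      rw [h, Complex.ofReal_one] at hre
      exact hone (hre ▸ isRoot_of_mem_roots hw.1)
    · rw [← hre, h]
      simp
  set m := Multiset.card Z with hm
  have hcard : φ.natDegree = 2 * Multiset.card U + m := by
    rw [(IsAlgClosed.splits φ).natDegree_eq_card_roots, ← hR, hRU]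
    simp only [Multiset.card_add, Multiset.card_map]
    rw [← hm]
    ring
  -- Two zeros at `-1` count as one pair with argument `π`; a single `-1` is left over exactly when
  -- the degree is odd.
  refine ⟨U.map Complex.arg + Multiset.replicate (m / 2) Real.pi, ?_, ?_, ?_⟩
  · simp only [Multiset.card_add, Multiset.card_map, Multiset.card_replicate, hcard]
    omega
  · intro s hs
    rw [Multiset.mem_add] at hs
    rcases hs with hs | hs
    · obtain ⟨w, hw, rfl⟩ := Multiset.mem_map.mp hs
      rw [hU, Multiset.mem_filter] at hw
      refine ⟨?_, Complex.arg_le_pi w⟩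
      have h0 : 0 ≤ w.arg := Complex.arg_nonneg_iff.mpr hw.2.le
      refine lt_of_le_of_ne h0 fun h => ?_
      have := (Complex.arg_eq_zero_iff.mp h.symm).2
      exact hw.2.ne' this
    · rw [Multiset.eq_of_mem_replicate hs]
      exact ⟨Real.pi_pos, le_rfl⟩
  · have hprod : (R.map fun a => X - C a).prod =
        (U.map fun a => (X - C a) * (X - C (starRingEnd ℂ a))).prod * (X + 1) ^ m := by
      conv_lhs => rw [hRU]
      rw [Multiset.map_add, Multiset.map_add, Multiset.prod_add, Multiset.prod_add,
        Multiset.map_map, Multiset.prod_map_mul, hZrep, Multiset.map_replicate,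
        Multiset.prod_replicate]
      simp
    have hUprod : (U.map fun a => (X - C a) * (X - C (starRingEnd ℂ a))).prod =
        ((U.map Complex.arg).map zeroPair).prod := by
      rw [Multiset.map_map]
      congr 1
      apply Multiset.map_congr rfl
      intro w hw
      rw [hU, Multiset.mem_filter] at hw
      exact (zeroPair_arg (hroot w hw.1)).symm
    conv_lhs => rw [(IsAlgClosed.splits φ).eq_prod_roots]
    rw [← hR, hprod, hUprod, Multiset.map_add, Multiset.prod_add, Multiset.map_replicate,
      Multiset.prod_replicate, zeroPair_pi, ← pow_mul]
    have hmod : φ.natDegree % 2 = m % 2 := by omega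
    rw [hmod]
    conv_lhs => rw [← Nat.mod_add_div m 2, pow_add]
    ring

theorem exists_monotone_fin {k : ℕ} {S : Multiset ℝ} (hS : S.card = k) :
    ∃ s : Fin k → ℝ, Monotone s ∧ Finset.univ.val.map s = S := by
  subst hS
  refine ⟨fun i => (S.sort (· ≤ ·)).get (i.cast (by simp)), ?_, ?_⟩
  · intro i j hij
    exact (S.pairwise_sort (· ≤ ·)).rel_get_of_le (by simpa using hij)
  · conv_rhs => rw [← Multiset.sort_eq S (· ≤ ·)]
    simp only [Fin.univ_val_map]
    congr 1
    apply List.ext_get <;> simp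

/-- The arguments are sorted and framed by `0` and `π`. Positivity of the inner ones is recorded
because it makes the branch of the power holomorphic at `1`. -/
theorem exists_mem_T_hasZeroArgs {d : ℕ} {φ : ℂ[X]} (hφ : φ ≠ 0) (hdeg : φ.natDegree = d)
    (hconj : conjPoly φ = φ) (hnorm : ∀ w, φ.IsRoot w → ‖w‖ = 1) (hone : φ.eval 1 ≠ 0) :
    ∃ t ∈ T d, HasZeroArgs d φ t ∧ ∀ j : Fin (d / 2), 0 < t j.succ.castSucc := by
  obtain ⟨S, hcard, hmem, hprod⟩ := exists_multiset_zeroPair hconj hnorm hone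
  rw [hdeg] at hcard hprod
  obtain ⟨s, hs, hsS⟩ := exists_monotone_fin hcard
  have hsmem : ∀ j, 0 < s j ∧ s j ≤ Real.pi := fun j =>
    hmem _ (hsS ▸ Multiset.mem_map_of_mem s (Finset.mem_univ j))
  set t : Fin (d / 2 + 2) → ℝ := Fin.snoc (Fin.cons 0 s : Fin (d / 2 + 1) → ℝ) Real.pi with ht
  have htj : ∀ j : Fin (d / 2), t j.succ.castSucc = s j := by
    intro j
    rw [ht, Fin.snoc_castSucc, Fin.cons_succ]
  have ht0 : t 0 = 0 := by
    rw [ht, ← Fin.castSucc_zero, Fin.snoc_castSucc, Fin.cons_zero]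
  have htl : t (Fin.last (d / 2 + 1)) = Real.pi := by
    rw [ht, Fin.snoc_last]
  refine ⟨t, ⟨?_, ht0, htl⟩, ⟨φ.leadingCoeff, leadingCoeff_ne_zero.mpr hφ, ?_⟩, ?_⟩
  · intro i j hij
    induction j using Fin.lastCases with
    | last =>
      rw [htl]
      induction i using Fin.lastCases with
      | last => rw [htl]
      | cast i =>
        induction i using Fin.cases with
        | zero => rw [Fin.castSucc_zero, ht0]; exact Real.pi_pos.le
        | succ i => rw [htj]; exact (hsmem i).2
    | cast j =>
      induction i using Fin.lastCases with
      | last => exact absurd hij (not_le.mpr (Fin.castSucc_lt_last j))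
      | cast i =>
        rw [Fin.castSucc_le_castSucc_iff] at hij
        induction i using Fin.cases with
        | zero =>
          rw [Fin.castSucc_zero, ht0]
          induction j using Fin.cases with
          | zero => rw [Fin.castSucc_zero, ht0]
          | succ j => rw [htj]; exact (hsmem j).1.le
        | succ i =>
          induction j using Fin.cases with
          | zero => exact absurd hij (not_le.mpr (Fin.succ_pos i))
          | succ j =>
            rw [htj, htj]
            exact hs (Fin.succ_le_succ_iff.mp hij)
  · conv_lhs => rw [hprod, ← hsS, Multiset.map_map]
    congr 1
    apply Finset.prod_congr rfl
    intro j _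
    rw [htj]
    rfl
  · intro j
    rw [htj]
    exact (hsmem j).1

/-! ### A real form of Cauchy's theorem for a boundary point of the unit disc -/

/-- Differentiability at `1` makes the difference quotient continuous up to the boundary, and
Cauchy's theorem needs holomorphy only in the interior. -/
theorem circleIntegral_dslope_one_eq_zero {f : ℂ → ℂ}
    (hc : ContinuousOn f (Metric.closedBall 0 1))
    (hd : ∀ z ∈ Metric.ball (0 : ℂ) 1, DifferentiableAt ℂ f z) (h1 : DifferentiableAt ℂ f 1) :
    ContinuousOn (dslope f 1) (Metric.closedBall 0 1) ∧
      (∮ z in C(0, 1), dslope f 1 z) = 0 := by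
  have hcont : ContinuousOn (dslope f 1) (Metric.closedBall 0 1) := by
    intro z hz
    rcases eq_or_ne z 1 with rfl | hne
    · exact (continuousAt_dslope_same.mpr h1).continuousWithinAt
    · exact (continuousWithinAt_dslope_of_ne hne).mpr (hc z hz)
  refine ⟨hcont, Complex.circleIntegral_eq_zero_of_differentiable_on_off_countable zero_le_one
    Set.countable_empty hcont ?_⟩
  rintro z ⟨hz, -⟩
  have hne : z ≠ 1 := by
    rintro rfl
    simp at hz
  exact (differentiableAt_dslope_of_ne hne).mpr (hd z hz)

theorem dslope_one_conj {f : ℂ → ℂ}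
    (hsymm : ∀ z : ℂ, ‖z‖ = 1 → f (starRingEnd ℂ z) = starRingEnd ℂ (f z))
    {z : ℂ} (hz : ‖z‖ = 1) (hne : z ≠ 1) :
    dslope f 1 (starRingEnd ℂ z) = starRingEnd ℂ (dslope f 1 z) := by
  have hne' : starRingEnd ℂ z ≠ 1 := by
    intro h
    apply hne
    rw [← Complex.conj_conj z, h, map_one]
  have h1 := hsymm 1 (by simp)
  rw [map_one] at h1
  rw [dslope_of_ne _ hne, dslope_of_ne _ hne', slope_def_field, slope_def_field, hsymm z hz,
    map_div₀, map_sub, map_sub, map_one, ← h1]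

/-- If `f` is continuous on the closed unit disc, holomorphic in the interior and at `1`, and
symmetric with respect to the real axis, then the real part of `z (f(z) - f(1)) / (z - 1)` has
mean `0` over the upper half circle. -/
theorem integral_re_mul_dslope_one_eq_zero {f : ℂ → ℂ}
    (hc : ContinuousOn f (Metric.closedBall 0 1))
    (hd : ∀ z ∈ Metric.ball (0 : ℂ) 1, DifferentiableAt ℂ f z) (h1 : DifferentiableAt ℂ f 1)
    (hsymm : ∀ z : ℂ, ‖z‖ = 1 → f (starRingEnd ℂ z) = starRingEnd ℂ (f z)) :
    Continuous (fun θ : ℝ =>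
      (Complex.exp (θ * Complex.I) * dslope f 1 (Complex.exp (θ * Complex.I))).re) ∧
    ∫ θ in (0 : ℝ)..Real.pi,
      (Complex.exp (θ * Complex.I) * dslope f 1 (Complex.exp (θ * Complex.I))).re = 0 := by
  obtain ⟨hcont, hint⟩ := circleIntegral_dslope_one_eq_zero hc hd h1
  set G : ℝ → ℂ := fun θ =>
    Complex.exp (θ * Complex.I) * dslope f 1 (Complex.exp (θ * Complex.I)) with hG
  have hGc : Continuous G := by
    refine Continuous.mul (by fun_prop) ?_
    refine hcont.comp_continuous (by fun_prop) fun θ => ?_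
    rw [mem_closedBall_zero_iff, Complex.norm_exp_ofReal_mul_I]
  have hre : Continuous fun θ => (G θ).re := Complex.continuous_re.comp hGc
  refine ⟨hre, ?_⟩
  -- On the circle `dz = i z dθ`, which is the origin of the factor `z` in `G`.
  have hfull : ∫ θ in (0 : ℝ)..(2 * Real.pi), G θ = 0 := by
    rw [circleIntegral] at hint
    have : (fun θ : ℝ => deriv (circleMap 0 1) θ • dslope f 1 (circleMap 0 1 θ)) =
        fun θ => Complex.I * G θ := by
      ext θ
      simp only [deriv_circleMap, circleMap_zero, Complex.ofReal_one, one_mul, smul_eq_mul, hG]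
      ring
    rw [this, intervalIntegral.integral_const_mul] at hint
    exact (mul_eq_zero.mp hint).resolve_left Complex.I_ne_zero
  have hfullre : ∫ θ in (0 : ℝ)..(2 * Real.pi), (G θ).re = 0 := by
    have h := Complex.reCLM.intervalIntegral_comp_comm
      (hGc.intervalIntegrable (μ := MeasureTheory.volume) 0 (2 * Real.pi))
    rw [hfull] at h
    simpa using h
  have hsym : ∀ θ : ℝ, (G (2 * Real.pi - θ)).re = (G θ).re := by
    intro θ
    have he : Complex.exp (((2 * Real.pi - θ : ℝ) : ℂ) * Complex.I) =
        starRingEnd ℂ (Complex.exp (θ * Complex.I)) := by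
      rw [conj_exp_mul_I]
      have := Complex.exp_periodic (((-θ : ℝ) : ℂ) * Complex.I)
      rw [← this]
      congr 1
      push_cast
      ring
    simp only [hG]
    rw [he]
    -- The point `1` is its own conjugate, so the symmetry of the derivative is not needed there.
    rcases eq_or_ne (Complex.exp (θ * Complex.I)) 1 with h | h
    · rw [h, map_one]
    · rw [dslope_one_conj hsymm (Complex.norm_exp_ofReal_mul_I θ) h, ← map_mul, Complex.conj_re]
  have hhalf := intervalIntegral.integral_comp_sub_left (a := 0) (b := Real.pi)
    (fun θ => (G θ).re) (2 * Real.pi)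
  simp only [hsym] at hhalf
  rw [show 2 * Real.pi - Real.pi = Real.pi by ring, sub_zero] at hhalf
  have hadd := intervalIntegral.integral_add_adjacent_intervals
    (hre.intervalIntegrable (μ := MeasureTheory.volume) 0 Real.pi)
    (hre.intervalIntegrable (μ := MeasureTheory.volume) Real.pi (2 * Real.pi))
  rw [hfullre] at hadd
  linarith

/-! ### Phases -/

/-- `α` is an argument of `x` (any real number, if `x = 0`). -/
def HasPhase (x : ℂ) (α : ℝ) : Prop := x = ‖x‖ * Complex.exp (α * Complex.I)

theorem HasPhase.mul {x y : ℂ} {α β : ℝ} (hx : HasPhase x α) (hy : HasPhase y β) :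
    HasPhase (x * y) (α + β) := by
  unfold HasPhase at *
  rw [norm_mul]
  conv_lhs => rw [hx, hy]
  push_cast
  rw [add_mul, Complex.exp_add]
  ring

theorem hasPhase_one : HasPhase 1 0 := by simp [HasPhase]

theorem HasPhase.pow {x : ℂ} {α : ℝ} (hx : HasPhase x α) (n : ℕ) : HasPhase (x ^ n) (n * α) := by
  induction n with
  | zero => simpa using hasPhase_one
  | succ n ih =>
    rw [pow_succ]
    convert ih.mul hx using 1
    push_cast
    ring

theorem HasPhase.prod {ι : Type*} (s : Finset ι) {x : ι → ℂ} {α : ι → ℝ}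
    (h : ∀ i ∈ s, HasPhase (x i) (α i)) : HasPhase (∏ i ∈ s, x i) (∑ i ∈ s, α i) := by
  classical
  induction s using Finset.induction_on with
  | empty => simpa using hasPhase_one
  | insert a s ha ih =>
    rw [Finset.prod_insert ha, Finset.sum_insert ha]
    exact (h a (Finset.mem_insert_self a s)).mul
      (ih fun i hi => h i (Finset.mem_insert_of_mem hi))

/-- For `β` in the principal range the logarithm is `log r + iβ`, so the principal power multiplies
the phase by `q`. -/
theorem hasPhase_cpow {x : ℂ} {r β : ℝ} (hr : 0 < r) (hβ : -Real.pi < β) (hβ' : β ≤ Real.pi)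
    (hx : x = r * Complex.exp (β * Complex.I)) (q : ℝ) : HasPhase (x ^ (q : ℂ)) (q * β) := by
  have hx0 : x ≠ 0 := by
    rw [hx]
    exact mul_ne_zero (Complex.ofReal_ne_zero.mpr hr.ne') (Complex.exp_ne_zero _)
  have hnorm : ‖x‖ = r := by
    rw [hx, norm_mul, Complex.norm_exp_ofReal_mul_I, mul_one, Complex.norm_real,
      Real.norm_of_nonneg hr.le]
  have hlog : Complex.log x = Real.log r + β * Complex.I := by
    rw [hx, Complex.log_ofReal_mul hr (Complex.exp_ne_zero _), Complex.log_exp] <;> simpa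
  rw [HasPhase, Complex.norm_cpow_real, hnorm, Complex.cpow_def_of_ne_zero hx0, hlog, add_mul,
    Complex.exp_add, Complex.ofReal_cpow hr.le,
    Complex.cpow_def_of_ne_zero (Complex.ofReal_ne_zero.mpr hr.ne'), Complex.ofReal_log hr.le]
  congr 2
  push_cast
  ring

/-- The sign of `sin (u/2)` decides the principal argument: `(u - π)/2` for `0 < u < 2π`, but `(u +
π)/2` for `-2π < u < 0`. This jump by `-π` at `u = 0` produces the pieces of `K`. -/
theorem one_sub_exp_mul_I (u : ℝ) :
    1 - Complex.exp (u * Complex.I) =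
      ((2 * Real.sin (u / 2) : ℝ) : ℂ) * Complex.exp (((u - Real.pi) / 2 : ℝ) * Complex.I) := by
  have h1 : Complex.exp (((u - Real.pi) / 2 : ℝ) * Complex.I) =
      -Complex.I * Complex.exp ((u / 2 : ℂ) * Complex.I) := by
    rw [← Complex.exp_neg_pi_div_two_mul_I, ← Complex.exp_add]
    congr 1
    push_cast
    ring
  have h2 : Complex.exp (u * Complex.I) =
      Complex.exp ((u / 2 : ℂ) * Complex.I) * Complex.exp ((u / 2 : ℂ) * Complex.I) := by
    rw [← Complex.exp_add]
    congr 1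
    ring
  have h3 : Complex.exp (-(u / 2 : ℂ) * Complex.I) * Complex.exp ((u / 2 : ℂ) * Complex.I) = 1 := by
    rw [← Complex.exp_add]
    simp
  rw [h1, h2]
  push_cast
  rw [Complex.sin]
  linear_combination (-1 : ℂ) * h3 + (Complex.exp (-(u / 2 : ℂ) * Complex.I) *
    Complex.exp ((u / 2 : ℂ) * Complex.I) - Complex.exp ((u / 2 : ℂ) * Complex.I) *
    Complex.exp ((u / 2 : ℂ) * Complex.I)) * Complex.I_sq

theorem hasPhase_one_sub_exp_cpow_of_pos {u : ℝ} (h0 : 0 < u) (h1 : u < 2 * Real.pi) (q : ℝ) :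
    HasPhase ((1 - Complex.exp (u * Complex.I)) ^ (q : ℂ)) (q * ((u - Real.pi) / 2)) := by
  have hs : 0 < Real.sin (u / 2) := Real.sin_pos_of_pos_of_lt_pi (by linarith) (by linarith)
  exact hasPhase_cpow (by positivity) (by linarith [Real.pi_pos]) (by linarith)
    (one_sub_exp_mul_I u) q

theorem hasPhase_one_sub_exp_cpow_of_neg {u : ℝ} (h0 : u < 0) (h1 : -(2 * Real.pi) < u) (q : ℝ) :
    HasPhase ((1 - Complex.exp (u * Complex.I)) ^ (q : ℂ)) (q * ((u + Real.pi) / 2)) := by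
  have hs : Real.sin (u / 2) < 0 := Real.sin_neg_of_neg_of_neg_pi_lt (by linarith) (by linarith)
  refine hasPhase_cpow (r := -(2 * Real.sin (u / 2))) (by linarith) (by linarith)
    (by linarith [Real.pi_pos]) ?_ q
  rw [one_sub_exp_mul_I]
  have : Complex.exp (((u + Real.pi) / 2 : ℝ) * Complex.I) =
      -Complex.exp (((u - Real.pi) / 2 : ℝ) * Complex.I) := by
    rw [← Complex.exp_add_pi_mul_I]
    congr 1
    push_cast
    ring
  rw [this]
  push_cast
  ring

/-! ### The power of a polynomial with zeros on the unit circle -/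

/-- The analytic branch in the unit disc of the `q`-th power of
`(1 + z)^e ∏ (1 - e^{-i s_j} z) (1 - e^{i s_j} z)`. -/
noncomputable def branchPow (q : ℝ) (e : ℕ) {k : ℕ} (s : Fin k → ℝ) (z : ℂ) : ℂ :=
  ((1 - z * Complex.exp (Real.pi * Complex.I)) ^ (q : ℂ)) ^ e *
    ∏ j, ((1 - z * Complex.exp ((-s j : ℝ) * Complex.I)) ^ (q : ℂ) *
      (1 - z * Complex.exp (s j * Complex.I)) ^ (q : ℂ))

/-- Each factor maps the closed disc into the closed right half plane, which meets the branch cut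
only at `0`; hence principal powers suffice. -/
theorem re_one_sub_mul_exp_nonneg {z : ℂ} (hz : ‖z‖ ≤ 1) (u : ℝ) :
    0 ≤ (1 - z * Complex.exp (u * Complex.I)).re := by
  have h := Complex.re_le_norm (z * Complex.exp (u * Complex.I))
  rw [norm_mul, Complex.norm_exp_ofReal_mul_I, mul_one] at h
  rw [Complex.sub_re, Complex.one_re]
  linarith

theorem continuousOn_branchPow {q : ℝ} (hq : 0 < q) (e : ℕ) {k : ℕ} (s : Fin k → ℝ) :
    ContinuousOn (branchPow q e s) (Metric.closedBall 0 1) := by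
  have key : ∀ u : ℝ, ContinuousOn (fun z : ℂ => (1 - z * Complex.exp (u * Complex.I)) ^ (q : ℂ))
      (Metric.closedBall 0 1) := by
    intro u z hz
    rw [mem_closedBall_zero_iff] at hz
    have h := Complex.continuousAt_cpow_const_of_re_pos (w := (q : ℂ))
      (Or.inl (re_one_sub_mul_exp_nonneg hz u)) (by simpa using hq)
    exact (ContinuousAt.comp (f := fun z : ℂ => 1 - z * Complex.exp (u * Complex.I)) h
      (by fun_prop)).continuousWithinAt
  unfold branchPow
  exact ((key _).pow e).mul (continuousOn_finsetProd _ fun j _ => (key _).mul (key _))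

theorem differentiableAt_branchPow (q : ℝ) (e : ℕ) {k : ℕ} {s : Fin k → ℝ} {z : ℂ}
    (h0 : 0 < (1 - z * Complex.exp (Real.pi * Complex.I)).re)
    (h1 : ∀ j, 0 < (1 - z * Complex.exp ((-s j : ℝ) * Complex.I)).re)
    (h2 : ∀ j, 0 < (1 - z * Complex.exp (s j * Complex.I)).re) :
    DifferentiableAt ℂ (branchPow q e s) z := by
  have key : ∀ u : ℝ, 0 < (1 - z * Complex.exp (u * Complex.I)).re →
      DifferentiableAt ℂ (fun z : ℂ => (1 - z * Complex.exp (u * Complex.I)) ^ (q : ℂ)) z := by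
    intro u hu
    exact DifferentiableAt.cpow_const (by fun_prop) (Or.inl hu)
  unfold branchPow
  exact ((key _ h0).pow e).mul
    (DifferentiableAt.fun_finsetProd fun j _ => (key _ (h1 j)).mul (key _ (h2 j)))

theorem differentiableAt_branchPow_of_mem_ball (q : ℝ) (e : ℕ) {k : ℕ} (s : Fin k → ℝ) {z : ℂ}
    (hz : z ∈ Metric.ball (0 : ℂ) 1) : DifferentiableAt ℂ (branchPow q e s) z := by
  rw [mem_ball_zero_iff] at hz
  have key : ∀ u : ℝ, 0 < (1 - z * Complex.exp (u * Complex.I)).re := by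
    intro u
    have h := Complex.re_le_norm (z * Complex.exp (u * Complex.I))
    rw [norm_mul, Complex.norm_exp_ofReal_mul_I, mul_one] at h
    rw [Complex.sub_re, Complex.one_re]
    linarith
  exact differentiableAt_branchPow q e (key _) (fun _ => key _) fun _ => key _

theorem differentiableAt_branchPow_one (q : ℝ) (e : ℕ) {k : ℕ} {s : Fin k → ℝ}
    (hs : ∀ j, 0 < s j ∧ s j ≤ Real.pi) : DifferentiableAt ℂ (branchPow q e s) 1 := by
  have hcos : ∀ u : ℝ, 0 < u → u ≤ Real.pi → Real.cos u < 1 := by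
    intro u h0 h1
    have := Real.strictAntiOn_cos ⟨le_rfl, Real.pi_pos.le⟩ ⟨h0.le, h1⟩ h0
    rwa [Real.cos_zero] at this
  have key : ∀ u : ℝ, Real.cos u < 1 → 0 < (1 - 1 * Complex.exp (u * Complex.I)).re := by
    intro u hu
    rw [one_mul, Complex.sub_re, Complex.one_re, Complex.exp_ofReal_mul_I_re]
    linarith
  refine differentiableAt_branchPow q e (key _ (hcos _ Real.pi_pos le_rfl)) (fun j => key _ ?_)
    fun j => key _ (hcos _ (hs j).1 (hs j).2)
  rw [Real.cos_neg]
  exact hcos _ (hs j).1 (hs j).2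

/-- Conjugation swaps the two factors of each pair and fixes `e^{iπ} = -1`. -/
theorem branchPow_conj (q : ℝ) (e : ℕ) {k : ℕ} (s : Fin k → ℝ) {z : ℂ} (hz : ‖z‖ ≤ 1) :
    branchPow q e s (starRingEnd ℂ z) = starRingEnd ℂ (branchPow q e s z) := by
  have key : ∀ u : ℝ, starRingEnd ℂ ((1 - z * Complex.exp (u * Complex.I)) ^ (q : ℂ)) =
      (1 - starRingEnd ℂ z * Complex.exp ((-u : ℝ) * Complex.I)) ^ (q : ℂ) := by
    intro u
    have harg : (1 - z * Complex.exp (u * Complex.I)).arg ≠ Real.pi := by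
      intro h
      have := (Complex.arg_eq_pi_iff.mp h).1
      linarith [re_one_sub_mul_exp_nonneg hz u]
    have h := Complex.conj_cpow _ (q : ℂ) harg
    rw [Complex.conj_ofReal] at h
    rw [← h, map_sub, map_one, map_mul, conj_exp_mul_I]
  have hpi : Complex.exp ((-Real.pi : ℝ) * Complex.I) = Complex.exp (Real.pi * Complex.I) := by
    rw [← conj_exp_mul_I, Complex.exp_pi_mul_I]
    simp
  unfold branchPow
  rw [map_mul, map_pow, key, hpi, map_prod]
  congr 1
  refine Finset.prod_congr rfl fun j _ => ?_
  rw [map_mul, key, key, neg_neg, mul_comm]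

/-- The phase of the factor belonging to the zeros `e^{± i s}` jumps by `- q π` at `s`. -/
theorem hasPhase_pair {θ s : ℝ} (hθ : 0 ≤ θ) (hθ' : θ < Real.pi) (hs : 0 < s)
    (hs' : s ≤ Real.pi) (hne : θ ≠ s) (q : ℝ) :
    HasPhase ((1 - Complex.exp (θ * Complex.I) * Complex.exp ((-s : ℝ) * Complex.I)) ^ (q : ℂ) *
      (1 - Complex.exp (θ * Complex.I) * Complex.exp (s * Complex.I)) ^ (q : ℂ))
      (q * (θ - if s < θ then Real.pi else 0)) := by
  have h1 : ∀ u : ℝ, Complex.exp (θ * Complex.I) * Complex.exp (u * Complex.I) =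
      Complex.exp ((θ + u : ℝ) * Complex.I) := by
    intro u
    rw [← Complex.exp_add]
    congr 1
    push_cast
    ring
  rw [h1, h1]
  -- Up to the factor `q` this contributes `(θ + s - π)/2`. The other factor adds `(θ - s - π)/2`
  -- past `s` and `(θ - s + π)/2` before it.
  have h2 := hasPhase_one_sub_exp_cpow_of_pos (u := θ + s) (by linarith) (by linarith) q
  split_ifs with h
  · have h3 := hasPhase_one_sub_exp_cpow_of_pos (u := θ + -s) (by linarith)
      (by linarith [Real.pi_pos]) q
    convert h3.mul h2 using 1
    ring
  · have hlt : θ < s := lt_of_le_of_ne (not_lt.mp h) hne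
    have h3 := hasPhase_one_sub_exp_cpow_of_neg (u := θ + -s) (by linarith)
      (by linarith [Real.pi_pos]) q
    convert h3.mul h2 using 1
    ring

theorem hasPhase_branchPow {θ : ℝ} (hθ : 0 ≤ θ) (hθ' : θ < Real.pi) (q : ℝ) (e : ℕ) {k : ℕ}
    {s : Fin k → ℝ} (hs : ∀ j, 0 < s j ∧ s j ≤ Real.pi) (hne : ∀ j, θ ≠ s j) :
    HasPhase (branchPow q e s (Complex.exp (θ * Complex.I)))
      (q * (e * (θ / 2) + ∑ j, (θ - if s j < θ then Real.pi else 0))) := by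
  have h0 : HasPhase ((1 - Complex.exp (θ * Complex.I) * Complex.exp (Real.pi * Complex.I)) ^
      (q : ℂ)) (q * (θ / 2)) := by
    have h := hasPhase_one_sub_exp_cpow_of_pos (u := θ + Real.pi) (by linarith [Real.pi_pos])
      (by linarith) q
    rw [← Complex.exp_add]
    convert h using 1
    · congr 3
      push_cast
      ring
    · ring
  have h1 := (h0.pow e).mul (HasPhase.prod Finset.univ fun j _ =>
    hasPhase_pair hθ hθ' (hs j).1 (hs j).2 (hne j) q)
  unfold branchPow
  convert h1 using 1
  rw [← Finset.mul_sum]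
  ring

/-- At `θ = 0` no jump has been passed, so the phase vanishes. -/
theorem branchPow_one {q : ℝ} {e k : ℕ} {s : Fin k → ℝ} (hs : ∀ j, 0 < s j ∧ s j ≤ Real.pi) :
    branchPow q e s 1 = ‖branchPow q e s 1‖ := by
  have h := hasPhase_branchPow le_rfl Real.pi_pos q e hs fun j => (hs j).1.ne
  have hs' : ∀ j, ¬ s j < 0 := fun j => not_lt.mpr (hs j).1.le
  simpa [HasPhase, hs'] using h

/-! ### The kernel -/

theorem exists_mem_Ioo_castSucc_succ {m : ℕ} {τ : Fin (m + 1) → ℝ} {θ : ℝ} (h0 : τ 0 < θ)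
    (h1 : θ < τ (Fin.last m)) (hne : ∀ i, θ ≠ τ i) :
    ∃ n : Fin m, θ ∈ Set.Ioo (τ n.castSucc) (τ n.succ) := by
  by_contra! h
  have hall : ∀ i, τ i < θ := by
    intro i
    induction i using Fin.induction with
    | zero => exact h0
    | succ i ih =>
      have := h i
      rw [Set.mem_Ioo, not_and, not_lt] at this
      exact lt_of_le_of_ne (this ih) (hne _).symm
  exact (hall _).not_gt h1

theorem K_eq_of_mem_Ioo {d : ℕ} {p : ℝ} {τ : Fin (d / 2 + 2) → ℝ} (hτ : Monotone τ) {θ : ℝ}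
    {n : Fin (d / 2 + 1)} (hn : θ ∈ Set.Ioo (τ n.castSucc) (τ n.succ)) :
    K d p τ θ = Real.sin ((d * p / 4 + 1 / 2) * θ - p / 2 * Real.pi * (n : ℕ)) /
      Real.sin (θ / 2) := by
  unfold K
  rw [Finset.sum_eq_single n, Set.indicator_of_mem hn]
  · intro m _ hm
    apply Set.indicator_of_notMem
    rintro ⟨h1, h2⟩
    rcases lt_or_gt_of_ne hm with h | h
    · have : τ m.succ ≤ τ n.castSucc := hτ (by rw [Fin.le_def]; exact h)
      linarith [hn.1]
    · have : τ n.succ ≤ τ m.castSucc := hτ (by rw [Fin.le_def]; exact h)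
      linarith [hn.2]
  · simp

/-- Between `τ_n` and `τ_{n+1}` exactly `n` of the inner arguments have been passed. -/
theorem sum_jumps {d : ℕ} {τ : Fin (d / 2 + 2) → ℝ} (hτ : Monotone τ) {θ : ℝ}
    {n : Fin (d / 2 + 1)} (hn : θ ∈ Set.Ioo (τ n.castSucc) (τ n.succ)) :
    ∑ j : Fin (d / 2), (θ - if τ j.succ.castSucc < θ then Real.pi else 0) =
      (d / 2 : ℕ) * θ - n * Real.pi := by
  have hiff : ∀ j : Fin (d / 2), τ j.succ.castSucc < θ ↔ (j : ℕ) < n := by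
    intro j
    constructor
    · intro h
      by_contra! hle
      have : τ n.succ ≤ τ j.succ.castSucc := hτ (by simpa [Fin.le_def] using hle)
      linarith [hn.2]
    · intro h
      have : τ j.succ.castSucc ≤ τ n.castSucc := hτ (by simpa [Fin.le_def] using h)
      linarith [hn.1]
  simp only [hiff]
  rw [Finset.sum_sub_distrib, Fin.sum_univ_eq_sum_range (fun j => if j < (n : ℕ) then Real.pi else 0),
    ← Finset.sum_filter]
  have hfil : (Finset.range (d / 2)).filter (fun j => j < (n : ℕ)) = Finset.range n := by
    ext j
    have := n.2
    simp only [Finset.mem_filter, Finset.mem_range]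
    omega
  rw [hfil]
  simp

/-- From `e^{iθ} - 1 = 2i sin(θ/2) e^{iθ/2}`: the phase is shifted by `θ/2`, which explains the
`1/2` and the denominator in `K`. -/
theorem re_exp_mul_div_eq {A B α θ : ℝ} (hs : Real.sin (θ / 2) ≠ 0) :
    (Complex.exp (θ * Complex.I) * ((A * Complex.exp (α * Complex.I) - B) /
      (Complex.exp (θ * Complex.I) - 1))).re =
      A * (Real.sin (α + θ / 2) / Real.sin (θ / 2)) / 2 - B / 2 := by
  have hden : Complex.exp (θ * Complex.I) - 1 =
      2 * Complex.I * Real.sin (θ / 2) * Complex.exp ((θ / 2 : ℝ) * Complex.I) := by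
    have h := one_sub_exp_mul_I θ
    have h1 : Complex.exp (((θ - Real.pi) / 2 : ℝ) * Complex.I) =
        -Complex.I * Complex.exp ((θ / 2 : ℝ) * Complex.I) := by
      rw [← Complex.exp_neg_pi_div_two_mul_I, ← Complex.exp_add]
      congr 1
      push_cast
      ring
    rw [h1] at h
    push_cast at h ⊢
    linear_combination -h
  have hexp : Complex.exp (θ * Complex.I) =
      Complex.exp ((θ / 2 : ℝ) * Complex.I) * Complex.exp ((θ / 2 : ℝ) * Complex.I) := by
    rw [← Complex.exp_add]
    congr 1
    push_cast
    ring
  have hs' : (Real.sin (θ / 2) : ℂ) ≠ 0 := Complex.ofReal_ne_zero.mpr hs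
  have hval : Complex.exp (θ * Complex.I) * ((A * Complex.exp (α * Complex.I) - B) /
      (Complex.exp (θ * Complex.I) - 1)) =
      ((1 / (2 * Real.sin (θ / 2)) : ℝ) : ℂ) * (-Complex.I *
        (A * Complex.exp ((α + θ / 2 : ℝ) * Complex.I) -
          B * Complex.exp ((θ / 2 : ℝ) * Complex.I))) := by
    have h2 : Complex.exp ((α + θ / 2 : ℝ) * Complex.I) =
        Complex.exp (α * Complex.I) * Complex.exp ((θ / 2 : ℝ) * Complex.I) := by
      rw [← Complex.exp_add]
      congr 1
      push_cast
      ring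
    rw [hden, hexp, h2]
    rw [show ((1 / (2 * Real.sin (θ / 2)) : ℝ) : ℂ) = 1 / (2 * (Real.sin (θ / 2) : ℂ)) by
      rw [Complex.ofReal_div, Complex.ofReal_mul]; norm_num]
    have hE := Complex.exp_ne_zero ((θ / 2 : ℝ) * Complex.I)
    have hI := Complex.I_ne_zero
    generalize Complex.exp ((θ / 2 : ℝ) * Complex.I) = E at hE ⊢
    generalize (Real.sin (θ / 2) : ℂ) = S at hs' ⊢
    generalize Complex.exp (α * Complex.I) = F
    field_simp
    rw [Complex.I_sq]
    ring
  rw [hval, Complex.re_ofReal_mul]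
  have h3 : (-Complex.I * (A * Complex.exp ((α + θ / 2 : ℝ) * Complex.I) -
      B * Complex.exp ((θ / 2 : ℝ) * Complex.I))).re =
      A * Real.sin (α + θ / 2) - B * Real.sin (θ / 2) := by
    have : ∀ x : ℂ, (-Complex.I * x).re = x.im := by intro x; simp
    rw [this, Complex.sub_im, Complex.im_ofReal_mul, Complex.im_ofReal_mul,
      Complex.exp_ofReal_mul_I_im, Complex.exp_ofReal_mul_I_im]
  rw [h3]
  field_simp

/-- The reproducing formula at the boundary point `1` for the branch of the power. -/
theorem integral_norm_branchPow_mul_K {d : ℕ} {p : ℝ} (hp : 0 < p) {τ : Fin (d / 2 + 2) → ℝ}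
    (hτ : τ ∈ T d) (hpos : ∀ j : Fin (d / 2), 0 < τ j.succ.castSucc) :
    IntervalIntegrable (fun θ : ℝ => ‖branchPow (p / 2) (d % 2)
      (fun j : Fin (d / 2) => τ j.succ.castSucc) (Complex.exp (θ * Complex.I))‖ * K d p τ θ)
      MeasureTheory.volume 0 Real.pi ∧
    ∫ θ in (0 : ℝ)..Real.pi, ‖branchPow (p / 2) (d % 2)
      (fun j : Fin (d / 2) => τ j.succ.castSucc) (Complex.exp (θ * Complex.I))‖ * K d p τ θ =
      Real.pi * ‖branchPow (p / 2) (d % 2) (fun j : Fin (d / 2) => τ j.succ.castSucc) 1‖ := by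
  obtain ⟨hmono, hτ0, hτl⟩ := hτ
  set s : Fin (d / 2) → ℝ := fun j => τ j.succ.castSucc with hs
  have hsmem : ∀ j, 0 < s j ∧ s j ≤ Real.pi := fun j =>
    ⟨hpos j, hτl ▸ hmono (Fin.le_last _)⟩
  set f := branchPow (p / 2) (d % 2) s with hf
  obtain ⟨hcont, hzero⟩ := integral_re_mul_dslope_one_eq_zero (f := f)
    (continuousOn_branchPow (half_pos hp) _ s)
    (fun z hz => differentiableAt_branchPow_of_mem_ball _ _ s hz)
    (differentiableAt_branchPow_one _ _ hsmem) fun z hz => branchPow_conj _ _ s hz.le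
  set H : ℝ → ℝ := fun θ =>
    (Complex.exp (θ * Complex.I) * dslope f 1 (Complex.exp (θ * Complex.I))).re with hH
  have hpt : ∀ θ ∈ Set.Ioo 0 Real.pi, θ ∉ Set.range τ →
      ‖f (Complex.exp (θ * Complex.I))‖ * K d p τ θ = 2 * H θ + ‖f 1‖ := by
    intro θ hθ hr
    have hne : ∀ i, θ ≠ τ i := fun i h => hr ⟨i, h.symm⟩
    obtain ⟨n, hn⟩ := exists_mem_Ioo_castSucc_succ (τ := τ) (hτ0 ▸ hθ.1) (hτl ▸ hθ.2) hne
    have hphase := hasPhase_branchPow hθ.1.le hθ.2 (p / 2) (d % 2) hsmem fun j => hne _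
    rw [sum_jumps hmono hn] at hphase
    rw [K_eq_of_mem_Ioo hmono hn]
    simp only [hH]
    rw [dslope_of_ne _ (exp_mul_I_ne_one hθ), slope_def_field]
    rw [HasPhase] at hphase
    have hsin : 0 < Real.sin (θ / 2) :=
      Real.sin_pos_of_pos_of_lt_pi (by linarith [hθ.1]) (by linarith [hθ.1, hθ.2])
    have hre := re_exp_mul_div_eq (A := ‖f (Complex.exp (θ * Complex.I))‖) (B := ‖f 1‖)
      (α := p / 2 * ((d % 2 : ℕ) * (θ / 2) + ((d / 2 : ℕ) * θ - n * Real.pi))) hsin.ne'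
    rw [← hphase, ← branchPow_one hsmem] at hre
    rw [hre]
    have hd : (d : ℝ) = (d % 2 : ℕ) + 2 * (d / 2 : ℕ) := by
      exact_mod_cast (Nat.mod_add_div d 2).symm
    have hang : p / 2 * ((d % 2 : ℕ) * (θ / 2) + ((d / 2 : ℕ) * θ - n * Real.pi)) + θ / 2 =
        (d * p / 4 + 1 / 2) * θ - p / 2 * Real.pi * (n : ℕ) := by
      rw [hd]
      ring
    rw [hang]
    ring
  have hae : ∀ᵐ θ : ℝ, θ ∈ Set.uIoc 0 Real.pi →
      2 * H θ + ‖f 1‖ = ‖f (Complex.exp (θ * Complex.I))‖ * K d p τ θ := by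
    have hfin : (Set.range τ).Finite := Set.finite_range τ
    filter_upwards [MeasureTheory.compl_mem_ae_iff.mpr
      (hfin.measure_zero MeasureTheory.volume)] with θ hθ hmem
    rw [Set.uIoc_of_le Real.pi_pos.le] at hmem
    refine (hpt θ ⟨hmem.1, lt_of_le_of_ne hmem.2 ?_⟩ hθ).symm
    rintro rfl
    exact hθ ⟨_, hτl⟩
  -- Integrability is inherited from this continuous function, equal to the integrand off the
  -- finitely many `τ_i`.
  have hHint : IntervalIntegrable (fun θ => 2 * H θ + ‖f 1‖) MeasureTheory.volume 0 Real.pi :=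
    ((continuous_const.mul hcont).add continuous_const).intervalIntegrable _ _
  constructor
  · refine hHint.congr_ae ?_
    rw [Filter.EventuallyEq, MeasureTheory.ae_restrict_iff' measurableSet_uIoc]
    exact hae
  · rw [← intervalIntegral.integral_congr_ae hae, intervalIntegral.integral_add
      ((hcont.intervalIntegrable _ _).const_mul 2)
      (continuous_const.intervalIntegrable _ _), intervalIntegral.integral_const_mul, hzero]
    simp

/-! ### The upper bound -/

theorem norm_eval_rpow_eq {d : ℕ} {φ : ℂ[X]} {τ : Fin (d / 2 + 2) → ℝ} (h : HasZeroArgs d φ τ)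
    (q : ℝ) : ∃ c : ℝ, ∀ z : ℂ, ‖φ.eval z‖ ^ q =
      c * ‖branchPow q (d % 2) (fun j : Fin (d / 2) => τ j.succ.castSucc) z‖ := by
  obtain ⟨c, -, rfl⟩ := h
  refine ⟨‖c‖ ^ q, fun z => ?_⟩
  -- The two zeros have product `1`, so the monic pair equals the pair normalized at `0`.
  have hfac : ∀ s : ℝ, (z - Complex.exp (s * Complex.I)) * (z - Complex.exp (-(s * Complex.I))) =
      (1 - z * Complex.exp ((-s : ℝ) * Complex.I)) * (1 - z * Complex.exp (s * Complex.I)) := by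
    intro s
    have h1 : Complex.exp (s * Complex.I) * Complex.exp (-(s * Complex.I)) = 1 := by
      rw [← Complex.exp_add, add_neg_cancel, Complex.exp_zero]
    push_cast
    rw [neg_mul]
    linear_combination (1 - z ^ 2) * h1
  simp only [branchPow, eval_mul, eval_pow, eval_add, eval_C, eval_X, Polynomial.eval_one,
    eval_prod, eval_sub, hfac, norm_mul, norm_pow, norm_prod, Complex.norm_cpow_real,
    Complex.exp_pi_mul_I]
  rw [Real.mul_rpow (by positivity) (by positivity), Real.mul_rpow (by positivity) (by positivity),
    ← Real.finsetProd_rpow _ _ (fun i _ => by positivity), mul_assoc]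
  congr 2
  · rw [← Real.rpow_natCast, ← Real.rpow_natCast, ← Real.rpow_mul (norm_nonneg _),
      ← Real.rpow_mul (norm_nonneg _), mul_comm q]
    congr 2
    ring
  · refine Finset.prod_congr rfl fun j _ => ?_
    rw [Real.mul_rpow (norm_nonneg _) (norm_nonneg _)]

/-- The reproducing formula for a power of the modulus of a polynomial. -/
theorem integral_norm_eval_rpow_mul_K {d : ℕ} {p : ℝ} (hp : 0 < p) {φ : ℂ[X]}
    {τ : Fin (d / 2 + 2) → ℝ} (hτ : τ ∈ T d) (hpos : ∀ j : Fin (d / 2), 0 < τ j.succ.castSucc)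
    (h : HasZeroArgs d φ τ) :
    IntervalIntegrable (fun θ : ℝ => ‖φ.eval (Complex.exp (θ * Complex.I))‖ ^ (p / 2) * K d p τ θ)
      MeasureTheory.volume 0 Real.pi ∧
    ∫ θ in (0 : ℝ)..Real.pi, ‖φ.eval (Complex.exp (θ * Complex.I))‖ ^ (p / 2) * K d p τ θ =
      Real.pi * ‖φ.eval 1‖ ^ (p / 2) := by
  obtain ⟨c, hc⟩ := norm_eval_rpow_eq h (p / 2)
  obtain ⟨hint, heq⟩ := integral_norm_branchPow_mul_K hp hτ hpos
  simp only [hc, mul_assoc]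
  refine ⟨hint.const_mul c, ?_⟩
  rw [intervalIntegral.integral_const_mul, heq]
  ring

/-! ### Comparison of kernels and Cauchy–Schwarz -/

theorem measurable_K (d : ℕ) (p : ℝ) (τ : Fin (d / 2 + 2) → ℝ) : Measurable (K d p τ) := by
  unfold K
  refine Finset.measurable_sum _ fun n _ => Measurable.indicator ?_ measurableSet_Ioo
  fun_prop

/-- A crude bound, uniform in `τ`: it keeps the real supremum in `M` from taking its default value
for unbounded sets. -/
theorem K_le (d : ℕ) (p : ℝ) (τ : Fin (d / 2 + 2) → ℝ) (θ : ℝ) :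
    K d p τ θ ≤ ∑ _n : Fin (d / 2 + 1), 1 / |Real.sin (θ / 2)| := by
  refine Finset.sum_le_sum fun n _ => ?_
  rw [Set.indicator_apply]
  split_ifs
  · refine (le_abs_self _).trans ?_
    rw [abs_div]
    have := Real.abs_sin_le_one ((d * p / 4 + 1 / 2) * θ - p / 2 * Real.pi * (n : ℕ))
    gcongr
  · positivity

theorem max_K_zero_le_M {d : ℕ} {p : ℝ} {Λ : Set (Fin (d / 2 + 2) → ℝ)}
    {τ : Fin (d / 2 + 2) → ℝ} (hτ : τ ∈ Λ) (θ : ℝ) : max (K d p τ θ) 0 ≤ M d p Λ θ := by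
  refine le_csSup ⟨∑ _n : Fin (d / 2 + 1), 1 / |Real.sin (θ / 2)|, ?_⟩ ⟨τ, hτ, rfl⟩
  rintro _ ⟨σ, -, rfl⟩
  exact max_le (K_le d p σ θ) (Finset.sum_nonneg fun _ _ => by positivity)

theorem lpMass_eq_of_conjPoly_eq {p : ℝ} (hp : 0 < p) {φ : ℂ[X]} (hconj : conjPoly φ = φ) :
    ∫ θ in (0 : ℝ)..Real.pi, ‖φ.eval (Complex.exp (θ * Complex.I))‖ ^ p =
      Real.pi * lpMass p φ := by
  set g : ℝ → ℝ := fun θ => ‖φ.eval (Complex.exp (θ * Complex.I))‖ ^ p / (2 * Real.pi) with hg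
  have hgc : Continuous g := continuous_lpMass_integrand hp φ
  have heven : ∀ θ, g (-θ) = g θ := by
    intro θ
    simp only [hg]
    rw [← conj_exp_mul_I, ← Complex.norm_conj, ← eval_conjPoly, hconj]
  have h1 := intervalIntegral.integral_comp_neg (a := 0) (b := Real.pi) g
  simp only [heven, neg_zero] at h1
  have h2 := intervalIntegral.integral_add_adjacent_intervals
    (hgc.intervalIntegrable (μ := MeasureTheory.volume) (-Real.pi) 0)
    (hgc.intervalIntegrable (μ := MeasureTheory.volume) 0 Real.pi)
  have h3 : lpMass p φ = ∫ θ in (-Real.pi)..Real.pi, g θ := rfl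
  have h4 : ∫ θ in (0 : ℝ)..Real.pi, g θ =
      (∫ θ in (0 : ℝ)..Real.pi, ‖φ.eval (Complex.exp (θ * Complex.I))‖ ^ p) / (2 * Real.pi) :=
    intervalIntegral.integral_div _ _
  have h5 : lpMass p φ = 2 * ∫ θ in (0 : ℝ)..Real.pi, g θ := by
    rw [h3, ← h2, ← h1]
    ring
  rw [h5, h4]
  generalize (∫ θ in (0 : ℝ)..Real.pi, ‖φ.eval (Complex.exp (θ * Complex.I))‖ ^ p) = J
  field_simp

/-- Cauchy–Schwarz in the reproducing formula at `1`, after the negative part of `K` is dropped. In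
`[0, ∞]` no integrability of the square is required. -/
theorem ofReal_pi_sq_le {d : ℕ} {p : ℝ} (hp : 0 < p) {φ : ℂ[X]} (hconj : conjPoly φ = φ)
    (hone : φ.eval 1 = 1) {τ : Fin (d / 2 + 2) → ℝ} (hτ : τ ∈ T d)
    (hpos : ∀ j : Fin (d / 2), 0 < τ j.succ.castSucc) (h : HasZeroArgs d φ τ) :
    ENNReal.ofReal Real.pi ^ 2 ≤ ENNReal.ofReal (Real.pi * lpMass p φ) *
      ∫⁻ θ in Set.Icc 0 Real.pi, ENNReal.ofReal (max (K d p τ θ) 0 ^ 2) := by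
  obtain ⟨hint, heq⟩ := integral_norm_eval_rpow_mul_K hp hτ hpos h
  rw [hone, norm_one, Real.one_rpow, mul_one] at heq
  set a : ℝ → ℝ := fun θ => ‖φ.eval (Complex.exp (θ * Complex.I))‖ ^ (p / 2) with ha
  have ha0 : ∀ θ, 0 ≤ a θ := fun θ => by positivity
  have hφc : Continuous fun θ : ℝ => ‖φ.eval (Complex.exp (θ * Complex.I))‖ :=
    (φ.continuous.comp (by fun_prop : Continuous fun θ : ℝ => Complex.exp (θ * Complex.I))).norm
  have hac : Continuous a := hφc.rpow_const fun _ => Or.inr (half_pos hp).le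
  have hint' : MeasureTheory.IntegrableOn (fun θ => a θ * K d p τ θ) (Set.Icc 0 Real.pi) := by
    rw [intervalIntegrable_iff_integrableOn_Icc_of_le Real.pi_pos.le] at hint
    exact hint
  have hmax : ∀ θ, a θ * max (K d p τ θ) 0 = max (a θ * K d p τ θ) 0 := by
    intro θ
    rw [mul_max_of_nonneg _ _ (ha0 θ), mul_zero]
  have hintmax : MeasureTheory.IntegrableOn (fun θ => a θ * max (K d p τ θ) 0)
      (Set.Icc 0 Real.pi) := by
    simp only [hmax]
    exact hint'.pos_part
  have h1 : ENNReal.ofReal Real.pi ≤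
      ∫⁻ θ in Set.Icc 0 Real.pi, ENNReal.ofReal (a θ) * ENNReal.ofReal (max (K d p τ θ) 0) := by
    calc ENNReal.ofReal Real.pi
        ≤ ENNReal.ofReal (∫ θ in Set.Icc 0 Real.pi, a θ * max (K d p τ θ) 0) := by
          apply ENNReal.ofReal_le_ofReal
          rw [intervalIntegral.integral_of_le Real.pi_pos.le,
            ← MeasureTheory.integral_Icc_eq_integral_Ioc] at heq
          refine heq.symm.trans_le (MeasureTheory.integral_mono hint' hintmax fun θ => ?_)
          exact mul_le_mul_of_nonneg_left (le_max_left _ _) (ha0 θ)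
      _ = ∫⁻ θ in Set.Icc 0 Real.pi, ENNReal.ofReal (a θ * max (K d p τ θ) 0) :=
          MeasureTheory.ofReal_integral_eq_lintegral_ofReal hintmax
            (Filter.Eventually.of_forall fun θ => mul_nonneg (ha0 θ) (le_max_right _ _))
      _ = _ := by simp only [ENNReal.ofReal_mul (ha0 _)]
  have h2 := h1.trans (ENNReal.lintegral_mul_le_Lp_mul_Lq
    (MeasureTheory.volume.restrict (Set.Icc 0 Real.pi)) Real.HolderConjugate.two_two
    (f := fun θ => ENNReal.ofReal (a θ)) (g := fun θ => ENNReal.ofReal (max (K d p τ θ) 0))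
    hac.measurable.ennreal_ofReal.aemeasurable
    ((measurable_K d p τ).max measurable_const).ennreal_ofReal.aemeasurable)
  have hsq : ∀ x : ENNReal, (x ^ (1 / 2 : ℝ)) ^ 2 = x := by
    intro x
    rw [← ENNReal.rpow_natCast, ← ENNReal.rpow_mul]
    norm_num
  have hA : ∫⁻ θ in Set.Icc 0 Real.pi, ENNReal.ofReal (a θ) ^ (2 : ℝ) =
      ENNReal.ofReal (Real.pi * lpMass p φ) := by
    have hpow : ∀ θ, ENNReal.ofReal (a θ) ^ (2 : ℝ) =
        ENNReal.ofReal (‖φ.eval (Complex.exp (θ * Complex.I))‖ ^ p) := by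
      intro θ
      rw [ENNReal.ofReal_rpow_of_nonneg (ha0 θ) zero_le_two, ha,
        ← Real.rpow_mul (norm_nonneg _), div_mul_cancel₀ p two_ne_zero]
    simp only [hpow]
    rw [← lpMass_eq_of_conjPoly_eq hp hconj, intervalIntegral.integral_of_le Real.pi_pos.le,
      ← MeasureTheory.integral_Icc_eq_integral_Ioc,
      MeasureTheory.ofReal_integral_eq_lintegral_ofReal]
    · exact (hφc.rpow_const fun _ => Or.inr hp.le).continuousOn.integrableOn_Icc
    · exact Filter.Eventually.of_forall fun θ => by positivity
  have hB : ∀ θ, ENNReal.ofReal (max (K d p τ θ) 0) ^ (2 : ℝ) =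
      ENNReal.ofReal (max (K d p τ θ) 0 ^ 2) := by
    intro θ
    rw [ENNReal.ofReal_rpow_of_nonneg (le_max_right _ _) zero_le_two]
    norm_num
  simp only [hA, hB] at h2
  calc ENNReal.ofReal Real.pi ^ 2 ≤ _ := pow_le_pow_left' h2 2
    _ = _ := by rw [mul_pow, hsq, hsq]

theorem ofReal_nikolskiiConst_le_energy {d : ℕ} {p : ℝ} (hp : 0 < p) {φ : ℂ[X]}
    (hφ : IsExtremal d p φ) (hconj : conjPoly φ = φ) {τ : Fin (d / 2 + 2) → ℝ} (hτ : τ ∈ T d)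
    (hpos : ∀ j : Fin (d / 2), 0 < τ j.succ.castSucc) (h : HasZeroArgs d φ τ)
    {Λ : Set (Fin (d / 2 + 2) → ℝ)} (hΛ : τ ∈ Λ) :
    ENNReal.ofReal (nikolskiiConst d p) ≤ energy d p Λ := by
  have hm := lpMass_pos hp hφ.ne_zero
  have hsq := ofReal_pi_sq_le hp hconj hφ.eval_one hτ hpos h
  have hmono : ∫⁻ θ in Set.Icc 0 Real.pi, ENNReal.ofReal (max (K d p τ θ) 0 ^ 2) ≤
      ∫⁻ θ in Set.Icc 0 Real.pi, ENNReal.ofReal (M d p Λ θ ^ 2) := by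
    -- Monotonicity of the lower integral needs no measurability of `M`.
    refine MeasureTheory.lintegral_mono fun θ => ENNReal.ofReal_le_ofReal ?_
    exact pow_le_pow_left₀ (le_max_right _ _) (max_K_zero_le_M hΛ θ) 2
  set I := ∫⁻ θ in Set.Icc 0 Real.pi, ENNReal.ofReal (M d p Λ θ ^ 2) with hI
  have hle : ENNReal.ofReal Real.pi ^ 2 ≤ ENNReal.ofReal (Real.pi * lpMass p φ) * I :=
    hsq.trans (by gcongr)
  have hpi0 : ENNReal.ofReal Real.pi ≠ 0 := (ENNReal.ofReal_pos.mpr Real.pi_pos).ne'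
  have hpit : ENNReal.ofReal Real.pi ≠ ⊤ := ENNReal.ofReal_ne_top
  have hm0 : ENNReal.ofReal (lpMass p φ) ≠ 0 := (ENNReal.ofReal_pos.mpr hm).ne'
  have hmt : ENNReal.ofReal (lpMass p φ) ≠ ⊤ := ENNReal.ofReal_ne_top
  have hle' : ENNReal.ofReal Real.pi ≤ ENNReal.ofReal (lpMass p φ) * I := by
    rw [ENNReal.ofReal_mul Real.pi_pos.le, sq, mul_assoc] at hle
    exact (ENNReal.mul_le_mul_iff_right hpi0 hpit).mp hle
  calc ENNReal.ofReal (nikolskiiConst d p)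
      ≤ ENNReal.ofReal (lpMass p φ)⁻¹ := ENNReal.ofReal_le_ofReal (hφ.nikolskiiConst_le hp)
    _ = (ENNReal.ofReal (lpMass p φ))⁻¹ := ENNReal.ofReal_inv_of_pos hm
    _ = (ENNReal.ofReal Real.pi)⁻¹ * ((ENNReal.ofReal (lpMass p φ))⁻¹ *
          ENNReal.ofReal Real.pi) := by
        rw [mul_left_comm, ENNReal.inv_mul_cancel hpi0 hpit, mul_one]
    _ ≤ (ENNReal.ofReal Real.pi)⁻¹ * ((ENNReal.ofReal (lpMass p φ))⁻¹ *
          (ENNReal.ofReal (lpMass p φ) * I)) := by gcongr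
    _ = (ENNReal.ofReal Real.pi)⁻¹ * I := by
        rw [← mul_assoc (ENNReal.ofReal (lpMass p φ))⁻¹, ENNReal.inv_mul_cancel hm0 hmt, one_mul]
    _ = energy d p Λ := by
        rw [energy, one_div, ENNReal.ofReal_inv_of_pos Real.pi_pos]

end PointEval

theorem theorem3p1 (d : ℕ) (hd : 2 ≤ d) (p : ℝ) (hp : 2 ≤ p) :
    ENNReal.ofReal (PointEval.nikolskiiConst d p) ≤ PointEval.energy d p (PointEval.T d) ∧
    ∃ (φ : Polynomial ℂ) (t : Fin (d / 2 + 2) → ℝ),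
      PointEval.IsExtremal d p φ ∧ t ∈ PointEval.T d ∧ PointEval.HasZeroArgs d φ t ∧
      ∀ Λ : Set (Fin (d / 2 + 2) → ℝ), Λ ⊆ PointEval.T d → t ∈ Λ →
        ENNReal.ofReal (PointEval.nikolskiiConst d p) ≤ PointEval.energy d p Λ := by
  have hp0 : 0 < p := by linarith
  obtain ⟨φ, hφ, hconj⟩ := PointEval.exists_isExtremal_conjPoly_eq (p := p) (by linarith) d
  obtain ⟨t, ht, hzero, hpos⟩ := PointEval.exists_mem_T_hasZeroArgs hφ.ne_zero
    (hφ.natDegree_eq hp0) hconj (fun w hw => hφ.norm_eq_one_of_isRoot hp0 hw)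
    (by rw [hφ.eval_one]; exact one_ne_zero)
  -- The first claim is the case `Λ = T d`.
  exact ⟨PointEval.ofReal_nikolskiiConst_le_energy hp0 hφ hconj ht hpos hzero ht, φ, t, hφ, ht,
    hzero, fun Λ _ htΛ =>
      PointEval.ofReal_nikolskiiConst_le_energy hp0 hφ hconj ht hpos hzero htΛ⟩
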